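/- Let $\alpha\ge 0$ be a real number and let $n,t$ be integers with $0\le t\le n-2$. For a finite simple graph $G$ let $\Theta(G,\alpha)$ be the largest eigenvalue of $A(G)+\alpha D(G)$, where $A(G)$ is the adjacency matrix and $D(G)$ the diagonal matrix of vertex degrees. Let $G\vee H$ denote the join of two vertex-disjoint graphs. Let $\pi=(d_1,\dots,d_n)$, $d_1\ge\dots\ge d_n$, be the degree sequence of some graph $K_t\vee H$ with $H$ a tree on $n-t$ vertices, and let $\Gamma(\pi,t;0)$ be the class of all graphs with degree sequence $\pi$ that are of the form $K_t\vee H$ with $H$ a tree on $n-t$ vertices. Put $\pi^*=(d_{t+1}-t,\dots,d_n-t)=:(\delta_0,\dots,\delta_{n-t-1})$. Let $T_{\pi^*}$ be the graph on $0,1,\dots,n-t-1$ constructed by breadth-first search as follows: going through $i=0,1,2,\dots$ in this order, join $i$ to the next $\delta_0$ (if $i=0$) respectively $\delta_i-1$ (if $i\ge1$) vertices that have not yet been used (vertex $0$, the root, counts as used from the start). A BFS-graph is a connected simple graph whose vertices can be ordered $v_0\prec v_1\prec\cdots\prec v_m$ so that the degrees are non-increasing, the distances $h(v_i)=\mathrm{dist}(v_i,v_0)$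 are non-decreasing, and, whenever $v\in N(u)\setminus N(x)$, $y\in N(x)\setminus N(u)$, $h(u)=h(x)=h(v)-1=h(y)-1$ and $u\prec x$, one has $v\prec y$. A BFS-tree is a BFS-graph that is a tree. Then $T_{\pi^*}$ is a BFS-tree with degree sequence $\pi^*$, and it is, up to isomorphism, the only one. Moreover $T_\pi^{(t)}=K_t\vee T_{\pi^*}$ is, up to isomorphism, the unique graph of $\Gamma(\pi,t;0)$ that maximizes $\Theta(\cdot,\alpha)$: a graph $G$ on $n$ vertices lies in $\Gamma(\pi,t;0)$ and satisfies $\Theta(G',\alpha)\le\Theta(G,\alpha)$ for all $G'\in\Gamma(\pi,t;0)$ if and only if $G\cong K_t\vee T_{\pi^*}$. -/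

import Mathlib

/-- The join `G ∨ H` of two vertex-disjoint graphs: their disjoint union together with all edges
between a vertex of `G` and a vertex of `H`. -/
def graphJoin {V W : Type*} (G : SimpleGraph V) (H : SimpleGraph W) : SimpleGraph (V ⊕ W) :=
  (G ⊕g H) ⊔ completeBipartiteGraph V W

open scoped Classical in
/-- The general matrix `M_α(G) = A(G) + α D(G)`. -/
noncomputable def generalMatrix {V : Type*} [Fintype V] (G : SimpleGraph V) (α : ℝ) :
    Matrix V V ℝ :=
  G.adjMatrix ℝ + α • Matrix.diagonal (fun v => (G.degree v : ℝ))

open scoped Classical in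
/-- The general spectral radius `Θ(G, α)`: the maximal eigenvalue of the real symmetric matrix
`M_α(G)`. -/
noncomputable def generalSpectralRadius {V : Type*} [Fintype V] (G : SimpleGraph V) (α : ℝ) : ℝ :=
  sSup {μ : ℝ | Module.End.HasEigenvalue (Matrix.toLin' (generalMatrix G α)) μ}

/-- `G` is a `Θ_α`-maximal graph of the class `𝒢`. -/
def IsThetaMaximal {V : Type*} [Fintype V] (α : ℝ) (𝒢 : Set (SimpleGraph V))
    (G : SimpleGraph V) : Prop :=
  G ∈ 𝒢 ∧ ∀ G' ∈ 𝒢, generalSpectralRadius G' α ≤ generalSpectralRadius G α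

open scoped Classical in
/-- `π` is the degree sequence of `G`: the vertices can be listed (each exactly once) as
`v₁, …, vₙ` with `d(vᵢ) = dᵢ`. -/
def HasDegreeSequence {V : Type*} [Fintype V] (G : SimpleGraph V) {n : ℕ} (π : Fin n → ℕ) : Prop :=
  ∃ v : Fin n ≃ V, ∀ i, G.degree (v i) = π i

/-- A `c`-cyclic graph: connected, with `m = n + c - 1` edges. -/
def IsCCyclic {V : Type*} [Fintype V] (G : SimpleGraph V) (c : ℕ) : Prop :=
  G.Connected ∧ G.edgeSet.ncard + 1 = Fintype.card V + c

/-- The class `Γ(π, t; c)` of `t`-cone `c`-cyclic graphs `K_t ∨ H` on `n` vertices with degree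
sequence `π`, realised up to isomorphism on the vertex set `Fin n`. -/
def coneClass {n : ℕ} (π : Fin n → ℕ) (t c : ℕ) : Set (SimpleGraph (Fin n)) :=
  {G | HasDegreeSequence G π ∧
    ∃ H : SimpleGraph (Fin (n - t)), IsCCyclic H c ∧
      Nonempty (G ≃g graphJoin (⊤ : SimpleGraph (Fin t)) H)}

/-- The sequence `π* = (d_{t+1} - t, …, d_n - t)`. In the degree sequence of a `t`-cone graph every
`d_j` is at least `t`, so that the subtraction is exact. -/
def reducedSequence {n : ℕ} (π : Fin n → ℕ) (t : ℕ) : Fin (n - t) → ℕ :=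
  fun j => π ⟨t + j, by have := j.isLt; omega⟩ - t

open scoped Classical in
/-- The listing `v₀ ≺ v₁ ≺ ⋯ ≺ v_m` of the vertices of `G` is a BFS-ordering: degrees are
non-increasing, the distances `h(·)` to `v₀` are non-decreasing, and if `u`, `x` are in the same
layer and `v ∈ N(u) \ N(x)`, `y ∈ N(x) \ N(u)` are in the next layer, then `u ≺ x` implies
`v ≺ y`. -/
structure IsBFSOrdering {V : Type*} [Fintype V] (G : SimpleGraph V) {m : ℕ}
    (e : Fin (m + 1) ≃ V) : Prop where
  degree_antitone : ∀ i j, i ≤ j → G.degree (e j) ≤ G.degree (e i)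
  dist_monotone : ∀ i j, i ≤ j → G.dist (e i) (e 0) ≤ G.dist (e j) (e 0)
  next_layer : ∀ u x v y : V,
    v ∈ G.neighborSet u \ G.neighborSet x → y ∈ G.neighborSet x \ G.neighborSet u →
    G.dist u (e 0) = G.dist x (e 0) →
    G.dist v (e 0) = G.dist u (e 0) + 1 → G.dist y (e 0) = G.dist u (e 0) + 1 →
    e.symm u < e.symm x → e.symm v < e.symm y

/-- A BFS-graph: a connected graph that has a BFS-ordering. -/
def IsBFSGraph {V : Type*} [Fintype V] (G : SimpleGraph V) : Prop :=
  G.Connected ∧ ∃ (m : ℕ) (e : Fin (m + 1) ≃ V), IsBFSOrdering G e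

/-- The number of vertices of the next layer that the breadth-first-search construction attaches
to the `i`-th vertex: `δ 0` for the root, `δ i - 1` for every other vertex. -/
def bfsChildCount {m : ℕ} (δ : Fin m → ℕ) (i : Fin m) : ℕ :=
  if (i : ℕ) = 0 then δ i else δ i - 1

/-- The position of the first child of the `i`-th vertex: the root and all the children of the
earlier vertices come before it. -/
def bfsFirstChild {m : ℕ} (δ : Fin m → ℕ) (i : Fin m) : ℕ :=
  1 + ∑ j ∈ Finset.Iio i, bfsChildCount δ j

/-- The tree `T_δ` obtained from the tree degree sequence `δ` by breadth-first search. The vertices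
are numbered layer by layer, and from left to right in each layer
(`v_{0,1}, v_{1,1}, …, v_{1,s₁}, v_{2,1}, …`). The `i`-th vertex is prescribed the degree `δ i`
and is joined to the next `bfsChildCount δ i` vertices that have not yet been used. -/
def bfsTree {m : ℕ} (δ : Fin m → ℕ) : SimpleGraph (Fin m) :=
  SimpleGraph.fromRel fun i k =>
    bfsFirstChild δ i ≤ (k : ℕ) ∧ (k : ℕ) < bfsFirstChild δ i + bfsChildCount δ i

/-! The class is finite, so it contains a maximal graph `K_t ∨ H`; the point is that its tree `H` is
forced. Let `g` be the positive Perron vector of `K_t ∨ H` and `f` its restriction to `H`. Replacing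
`H` by a connected `H'` with permuted degrees changes the quadratic form at `g` only by the
difference of the forms of `H'` and `H` at `f`. By the Rayleigh principle `H` is therefore optimal
at `f`, and a tie makes `g` an eigenvector of both joins for the same eigenvalue, so that both
matrices act equally on `f` (`exists_isExtremalWeight`).

Two local moves exploit this. Moving neighbours between two vertices so that they trade degrees
shows that larger degree means strictly larger weight (`lt_of_degree_lt`). Switching two edges of a
path `a - b ⋯ c - d` shows that `f a`, `f d` compare as `f b`, `f c` do (`switch`). With the root at
a vertex of maximal weight, weights do not increase from layer to layer and follow the order of the
parents inside a layer. Sorting by layer, then parent, then weight thus gives a BFS-ordering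
(`exists_isBFSOrdering`).

In a tree with a BFS-ordering the position of the parent is monotone in that of the child, so the
children of each vertex fill a block whose place is dictated by the degrees
(`parent_eq_iff_bfsFirstChild`). Hence the tree is `bfsTree` of its sorted degrees. Applied to the
maximal `H`, this also shows that `bfsTree` is a BFS-tree with the right degrees, with no direct
check of the construction. -/

/-! ### Rayleigh principle and Perron vectors. -/

open scoped Classical in
theorem generalMatrix_mulVec_apply {V : Type*} [Fintype V] (G : SimpleGraph V) (α : ℝ)
    (f : V → ℝ) (v : V) :
    (generalMatrix G α).mulVec f v =
      (∑ w, if G.Adj v w then f w else 0) + α * (G.degree v * f v) := by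
  simp only [generalMatrix, Matrix.add_mulVec, Matrix.smul_mulVec, Pi.add_apply, Pi.smul_apply,
    Matrix.mulVec_diagonal, smul_eq_mul]
  congr 1
  simp [Matrix.mulVec, dotProduct, SimpleGraph.adjMatrix_apply]

theorem generalMatrix_isHermitian {V : Type*} [Fintype V] (G : SimpleGraph V) (α : ℝ) :
    (generalMatrix G α).IsHermitian := by
  ext i j
  simp only [generalMatrix, Matrix.conjTranspose_apply, Matrix.add_apply, Matrix.smul_apply,
    Matrix.diagonal_apply, SimpleGraph.adjMatrix_apply, star_trivial]
  by_cases h : i = j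
  · subst h; rfl
  · simp only [h, Ne.symm h, if_false, smul_zero, add_zero]
    congr 1
    exact propext (G.adj_comm j i)

open scoped Classical in
theorem generalSpectralRadius_eq_sSup_spectrum {V : Type*} [Fintype V] (G : SimpleGraph V)
    (α : ℝ) : generalSpectralRadius G α = sSup (spectrum ℝ (generalMatrix G α)) := by
  unfold generalSpectralRadius
  congr 1
  ext μ
  rw [Set.mem_ofPred_eq, Module.End.hasEigenvalue_iff_mem_spectrum, Matrix.spectrum_toLin']

open scoped Classical in
theorem generalSpectralRadius_mem_spectrum {V : Type*} [Fintype V] [Nonempty V]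
    (G : SimpleGraph V) (α : ℝ) :
    generalSpectralRadius G α ∈ spectrum ℝ (generalMatrix G α) := by
  rw [generalSpectralRadius_eq_sSup_spectrum]
  refine Set.Nonempty.csSup_mem ?_ (Matrix.finite_real_spectrum)
  exact ⟨_, (generalMatrix_isHermitian G α).eigenvalues_mem_spectrum_real (Classical.arbitrary V)⟩

-- The eigenvalues of this difference are `Θ - μ` with `μ` in the spectrum, and `Θ` is its maximum.
-- Both the Rayleigh bound and its equality case are read off from semidefiniteness.
open scoped Classical in
theorem posSemidef_generalSpectralRadius_sub {V : Type*} [Fintype V] [Nonempty V]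
    (G : SimpleGraph V) (α : ℝ) :
    (algebraMap ℝ (Matrix V V ℝ) (generalSpectralRadius G α) - generalMatrix G α).PosSemidef := by
  have hH : (algebraMap ℝ (Matrix V V ℝ) (generalSpectralRadius G α) -
      generalMatrix G α).IsHermitian := by
    refine Matrix.IsHermitian.sub ?_ (generalMatrix_isHermitian G α)
    rw [Matrix.algebraMap_eq_diagonal]
    exact Matrix.isHermitian_diagonal _
  rw [hH.posSemidef_iff_eigenvalues_nonneg]
  intro i
  have h := hH.eigenvalues_mem_spectrum_real i
  rw [← spectrum.singleton_sub_eq] at h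
  obtain ⟨a, ha, b, hb, hab⟩ := Set.mem_sub.1 h
  rw [Set.mem_singleton_iff] at ha
  have : b ≤ generalSpectralRadius G α := by
    rw [generalSpectralRadius_eq_sSup_spectrum]
    exact le_csSup (Matrix.finite_real_spectrum).bddAbove hb
  simp only [Pi.zero_apply]
  rw [← hab, ha]
  linarith

open scoped Classical in
theorem sub_mulVec_generalSpectralRadius {V : Type*} [Fintype V]
    (G : SimpleGraph V) (α : ℝ) (f : V → ℝ) :
    (algebraMap ℝ (Matrix V V ℝ) (generalSpectralRadius G α) - generalMatrix G α).mulVec f =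
      generalSpectralRadius G α • f - (generalMatrix G α).mulVec f := by
  rw [Matrix.sub_mulVec, Algebra.algebraMap_eq_smul_one, Matrix.smul_mulVec, Matrix.one_mulVec]

/-- The Rayleigh quotient is at most the general spectral radius. -/
theorem dotProduct_generalMatrix_le {V : Type*} [Fintype V] [Nonempty V] (G : SimpleGraph V)
    (α : ℝ) (f : V → ℝ) :
    f ⬝ᵥ (generalMatrix G α).mulVec f ≤ generalSpectralRadius G α * (f ⬝ᵥ f) := by
  classical
  have h := (posSemidef_generalSpectralRadius_sub G α).dotProduct_mulVec_nonneg f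
  rw [sub_mulVec_generalSpectralRadius, star_trivial, dotProduct_sub, dotProduct_smul,
    smul_eq_mul] at h
  linarith

/-- Equality in the Rayleigh quotient bound only holds at eigenvectors. -/
theorem generalMatrix_mulVec_eq_of_dotProduct_eq {V : Type*} [Fintype V] [Nonempty V]
    (G : SimpleGraph V) (α : ℝ) (f : V → ℝ)
    (h : generalSpectralRadius G α * (f ⬝ᵥ f) ≤ f ⬝ᵥ (generalMatrix G α).mulVec f) :
    (generalMatrix G α).mulVec f = generalSpectralRadius G α • f := by
  classical
  have h0 := (posSemidef_generalSpectralRadius_sub G α).dotProduct_mulVec_zero_iff f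
  rw [sub_mulVec_generalSpectralRadius, star_trivial, dotProduct_sub, dotProduct_smul,
    smul_eq_mul] at h0
  have := h0.1 (by linarith [dotProduct_generalMatrix_le G α f])
  exact (sub_eq_zero.1 this).symm

theorem exists_eigenvector_generalSpectralRadius {V : Type*} [Fintype V] [Nonempty V]
    (G : SimpleGraph V) (α : ℝ) :
    ∃ f : V → ℝ, f ≠ 0 ∧ (generalMatrix G α).mulVec f = generalSpectralRadius G α • f := by
  classical
  have h := generalSpectralRadius_mem_spectrum G α
  rw [← Matrix.spectrum_toLin', ← Module.End.hasEigenvalue_iff_mem_spectrum] at h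
  obtain ⟨f, hf⟩ := h.exists_hasEigenvector
  exact ⟨f, hf.2, by simpa using hf.apply_eq_smul⟩

/-- A connected graph has a positive Perron vector. -/
theorem exists_pos_eigenvector {V : Type*} [Fintype V] {G : SimpleGraph V} (hG : G.Connected)
    (α : ℝ) : ∃ f : V → ℝ, (∀ v, 0 < f v) ∧
      (generalMatrix G α).mulVec f = generalSpectralRadius G α • f := by
  classical
  have := hG.nonempty
  obtain ⟨f, hf0, hf⟩ := exists_eigenvector_generalSpectralRadius G α
  have hsq : (fun v => |f v|) ⬝ᵥ (fun v => |f v|) = f ⬝ᵥ f := by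
    simp [dotProduct]
  -- Off-diagonal entries are nonnegative and the diagonal part sees only squares, so `|f|` attains
  -- the maximum as well. No sign condition on `α` is needed.
  have hle : f ⬝ᵥ (generalMatrix G α).mulVec f ≤
      (fun v => |f v|) ⬝ᵥ (generalMatrix G α).mulVec (fun v => |f v|) := by
    simp only [dotProduct, generalMatrix_mulVec_apply, mul_add, Finset.mul_sum]
    refine Finset.sum_le_sum fun v _ => add_le_add (Finset.sum_le_sum fun w _ => ?_) (le_of_eq ?_)
    · split_ifs
      · rw [← abs_mul]; exact le_abs_self _
      · simp
    · have := abs_mul_abs_self (f v)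
      linear_combination -(α * G.degree v) * this
  have hg := generalMatrix_mulVec_eq_of_dotProduct_eq G α (fun v => |f v|) (by
    rw [hsq]; refine le_trans (le_of_eq ?_) hle; rw [hf, dotProduct_smul, smul_eq_mul])
  -- At a zero of `|f|` the eigenvalue equation says that a sum of nonnegative neighbour values
  -- vanishes; zeros therefore spread along edges.
  have hz : ∀ v w, G.Adj v w → f v = 0 → f w = 0 := by
    intro v w hvw hv
    have h := congrFun hg v
    rw [generalMatrix_mulVec_apply] at h
    simp only [hv, abs_zero, mul_zero, add_zero, Pi.smul_apply, smul_eq_mul] at h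
    rw [Finset.sum_eq_zero_iff_of_nonneg (fun w _ => by split_ifs <;> simp)] at h
    simpa [hvw] using h w (Finset.mem_univ w)
  refine ⟨_, fun v => abs_pos.2 fun hv => hf0 ?_, hg⟩
  ext w
  obtain ⟨p⟩ := hG.preconnected v w
  induction p with
  | nil => exact hv
  | cons hadj _ ih => exact ih (hz _ _ hadj hv)

theorem generalSpectralRadius_congr {V W : Type*} [Fintype V] [Fintype W] {G : SimpleGraph V}
    {H : SimpleGraph W} (e : G ≃g H) (α : ℝ) :
    generalSpectralRadius G α = generalSpectralRadius H α := by
  classical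
  rw [generalSpectralRadius_eq_sSup_spectrum, generalSpectralRadius_eq_sSup_spectrum]
  have : generalMatrix G α = Matrix.reindexAlgEquiv ℝ ℝ e.symm.toEquiv (generalMatrix H α) := by
    ext i j
    have h1 : (e.symm.toEquiv).symm = e.toEquiv := rfl
    simp only [generalMatrix, Matrix.coe_reindexAlgEquiv, Matrix.reindex_apply,
      Matrix.submatrix_apply, Matrix.add_apply, Matrix.smul_apply, h1,
      Matrix.diagonal_apply, SimpleGraph.adjMatrix_apply]
    congr 1
    · exact if_congr (e.map_adj_iff (v := i) (w := j)).symm rfl rfl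
    · congr 1
      by_cases h : i = j
      · subst h
        simp only [if_true]
        norm_cast
        exact (e.degree_eq i).symm
      · rw [if_neg h, if_neg (fun h' => h (e.toEquiv.injective h'))]
  rw [this]
  congr 1
  exact AlgEquiv.spectrum_eq _ _

/-! ### Exchanging adjacencies between two vertices. -/

open scoped Classical in
/-- The graph obtained from `H` by letting every vertex of `X` exchange its adjacencies
to `u` and `v`. -/
def SimpleGraph.exchange {V : Type*} (H : SimpleGraph V) (u v : V) (X : Set V) (hu : u ∉ X)
    (hv : v ∉ X) : SimpleGraph V where
  Adj x y := H.Adj (if y ∈ X then Equiv.swap u v x else x) (if x ∈ X then Equiv.swap u v y else y)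
  symm := ⟨fun _ _ h => h.symm⟩
  loopless := ⟨fun x h => by
    by_cases hx : x ∈ X
    · rw [if_pos hx, Equiv.swap_apply_of_ne_of_ne (by rintro rfl; exact hu hx)
        (by rintro rfl; exact hv hx)] at h
      exact H.irrefl h
    · rw [if_neg hx] at h
      exact H.irrefl h⟩

open scoped Classical in
/-- The real adjacency indicator. -/
noncomputable def SimpleGraph.adjInd {V : Type*} (H : SimpleGraph V) (x y : V) : ℝ :=
  if H.Adj x y then 1 else 0

theorem SimpleGraph.adjInd_comm {V : Type*} (H : SimpleGraph V) (x y : V) :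
    H.adjInd x y = H.adjInd y x := by
  unfold adjInd
  congr 1
  exact propext (H.adj_comm x y)

theorem SimpleGraph.adjInd_of_adj {V : Type*} {H : SimpleGraph V} {x y : V} (h : H.Adj x y) :
    H.adjInd x y = 1 := if_pos h

theorem SimpleGraph.adjInd_of_not_adj {V : Type*} {H : SimpleGraph V} {x y : V}
    (h : ¬ H.Adj x y) : H.adjInd x y = 0 := if_neg h

open scoped Classical in
theorem SimpleGraph.degree_eq_sum_adjInd {V : Type*} [Fintype V] (H : SimpleGraph V) (x : V) :
    (H.degree x : ℝ) = ∑ y, H.adjInd x y := by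
  simp [adjInd, Finset.sum_boole, ← H.card_neighborFinset_eq_degree, H.neighborFinset_eq_filter]

open scoped Classical in
theorem generalMatrix_mulVec_eq_adjInd {V : Type*} [Fintype V] (H : SimpleGraph V) (α : ℝ)
    (f : V → ℝ) (x : V) : (generalMatrix H α).mulVec f x =
      ∑ y, H.adjInd x y * f y + α * ((∑ y, H.adjInd x y) * f x) := by
  rw [generalMatrix_mulVec_apply, H.degree_eq_sum_adjInd]
  simp [SimpleGraph.adjInd]

section Exchange

variable {V : Type*} (H : SimpleGraph V) {u v : V} {X : Set V} (hu : u ∉ X) (hv : v ∉ X)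

-- Swapping the entries at `u` and `v` in a row adds their difference times `e_v - e_u`. Since `X`
-- avoids `u` and `v`, the row and column corrections never overlap.
open scoped Classical in
theorem SimpleGraph.adjInd_exchange (huv : u ≠ v) (x y : V) :
    (H.exchange u v X hu hv).adjInd x y = H.adjInd x y +
      (if x ∈ X then (H.adjInd x u - H.adjInd x v) *
        ((if y = v then 1 else 0) - (if y = u then 1 else 0)) else 0) +
      (if y ∈ X then (H.adjInd u y - H.adjInd v y) *
        ((if x = v then 1 else 0) - (if x = u then 1 else 0)) else 0) := by
  have key : (H.exchange u v X hu hv).adjInd x y = H.adjInd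
      (if y ∈ X then Equiv.swap u v x else x) (if x ∈ X then Equiv.swap u v y else y) := rfl
  rw [key]
  have hsw : ∀ z ∈ X, Equiv.swap u v z = z := fun z hz => Equiv.swap_apply_of_ne_of_ne
    (by rintro rfl; exact hu hz) (by rintro rfl; exact hv hz)
  have hzu : ∀ z ∈ X, z ≠ u := fun z hz => by rintro rfl; exact hu hz
  have hzv : ∀ z ∈ X, z ≠ v := fun z hz => by rintro rfl; exact hv hz
  by_cases hx : x ∈ X <;> by_cases hy : y ∈ X
  · simp [hx, hy, hsw x hx, hsw y hy, hzu x hx, hzu y hy, hzv x hx, hzv y hy]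
  · by_cases h1 : y = u
    · subst h1; simp [hx, hy, huv]
    · by_cases h2 : y = v
      · subst h2; simp [hx, hy, Ne.symm huv]
      · simp [hx, hy, h1, h2, Equiv.swap_apply_of_ne_of_ne h1 h2]
  · by_cases h1 : x = u
    · subst h1; simp [hx, hy, huv]
    · by_cases h2 : x = v
      · subst h2; simp [hx, hy, Ne.symm huv]
      · simp [hx, hy, h1, h2, Equiv.swap_apply_of_ne_of_ne h1 h2]
  · simp [hx, hy]

/-- The signed weight moved by an exchange. -/
noncomputable def SimpleGraph.exchangeWeight [Fintype V] (u v : V) (X : Set V) (f : V → ℝ) : ℝ :=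
  open scoped Classical in ∑ y, if y ∈ X then (H.adjInd u y - H.adjInd v y) * f y else 0

open scoped Classical in
theorem SimpleGraph.sum_adjInd_exchange [Fintype V] (huv : u ≠ v) (f : V → ℝ) (x : V) :
    ∑ y, (H.exchange u v X hu hv).adjInd x y * f y = ∑ y, H.adjInd x y * f y +
      (if x ∈ X then (H.adjInd x u - H.adjInd x v) * (f v - f u) else 0) +
      ((if x = v then 1 else 0) - (if x = u then 1 else 0)) * H.exchangeWeight u v X f := by
  simp only [H.adjInd_exchange hu hv huv, add_mul, Finset.sum_add_distrib, exchangeWeight]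
  congr 1
  · congr 1
    split_ifs with hx
    · simp only [mul_assoc, ← Finset.mul_sum, sub_mul, ite_mul, one_mul, zero_mul,
        Finset.sum_sub_distrib, Finset.sum_ite_eq', Finset.mem_univ, if_true]
    · simp
  · rw [Finset.mul_sum]
    refine Finset.sum_congr rfl fun y _ => ?_
    split_ifs <;> ring

open scoped Classical in
theorem SimpleGraph.generalMatrix_exchange_mulVec [Fintype V] (huv : u ≠ v) (α : ℝ) (f : V → ℝ)
    (x : V) :
    (generalMatrix (H.exchange u v X hu hv) α).mulVec f x = (generalMatrix H α).mulVec f x +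
      (if x ∈ X then (H.adjInd x u - H.adjInd x v) * (f v - f u) else 0) +
      ((if x = v then 1 else 0) - (if x = u then 1 else 0)) *
        (H.exchangeWeight u v X f + α * (H.exchangeWeight u v X 1 * f x)) := by
  have h1 := H.sum_adjInd_exchange hu hv huv 1 x
  simp only [Pi.one_apply, mul_one, sub_self, mul_zero, ite_self, add_zero] at h1
  rw [generalMatrix_mulVec_eq_adjInd, generalMatrix_mulVec_eq_adjInd,
    H.sum_adjInd_exchange hu hv huv f, h1]
  ring

open scoped Classical in
theorem SimpleGraph.degree_exchange [Fintype V] (huv : u ≠ v) (x : V) :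
    ((H.exchange u v X hu hv).degree x : ℝ) = H.degree x +
      ((if x = v then 1 else 0) - (if x = u then 1 else 0)) * H.exchangeWeight u v X 1 := by
  have h1 := H.sum_adjInd_exchange hu hv huv 1 x
  simp only [Pi.one_apply, mul_one, sub_self, mul_zero, ite_self, add_zero] at h1
  rw [degree_eq_sum_adjInd, degree_eq_sum_adjInd, h1]

-- The row and column corrections contribute equally, whence the factor 2; the degree change
-- contributes `f v ^ 2 - f u ^ 2`. The common factor `f v - f u` lets the sign be read off.
open scoped Classical in
theorem SimpleGraph.dotProduct_generalMatrix_exchange [Fintype V] (huv : u ≠ v) (α : ℝ)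
    (f : V → ℝ) :
    f ⬝ᵥ (generalMatrix (H.exchange u v X hu hv) α).mulVec f =
      f ⬝ᵥ (generalMatrix H α).mulVec f + (f v - f u) *
        (2 * H.exchangeWeight u v X f + α * H.exchangeWeight u v X 1 * (f v + f u)) := by
  simp only [dotProduct, H.generalMatrix_exchange_mulVec hu hv huv, mul_add,
    Finset.sum_add_distrib]
  rw [add_assoc]
  congr 1
  have e1 : ∑ x, f x * (if x ∈ X then (H.adjInd x u - H.adjInd x v) * (f v - f u) else 0) =
      (f v - f u) * H.exchangeWeight u v X f := by
    rw [exchangeWeight, Finset.mul_sum]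
    refine Finset.sum_congr rfl fun x _ => ?_
    rw [H.adjInd_comm x u, H.adjInd_comm x v]
    split_ifs <;> ring
  have e2 : ∀ F : V → ℝ, ∑ x, f x * (((if x = v then 1 else 0) - (if x = u then 1 else 0)) * F x)
      = f v * F v - f u * F u := by
    intro F
    simp [sub_mul, mul_sub, Finset.sum_sub_distrib]
  have e3 := e2 fun x => H.exchangeWeight u v X f + α * (H.exchangeWeight u v X 1 * f x)
  simp only [mul_add, Finset.sum_add_distrib] at e3
  rw [e1, e3]
  ring

/-- An edge of `H` survives up to trading its end `u` for `v` or conversely, and this is harmless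
once `u` and `v` are still linked. -/
theorem SimpleGraph.Connected.exchange (hH : H.Connected)
    (huv : (H.exchange u v X hu hv).Reachable u v) : (H.exchange u v X hu hv).Connected := by
  classical
  have := hH.nonempty
  have hsw : ∀ z w, (H.exchange u v X hu hv).Reachable z (Equiv.swap u v w) →
      (H.exchange u v X hu hv).Reachable z w := by
    intro z w h
    by_cases h1 : w = u
    · subst h1; rw [Equiv.swap_apply_left] at h; exact h.trans huv.symm
    · by_cases h2 : w = v
      · subst h2; rw [Equiv.swap_apply_right] at h; exact h.trans huv
      · rwa [Equiv.swap_apply_of_ne_of_ne h1 h2] at h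
  have hzX : ∀ z ∈ X, Equiv.swap u v z = z := fun z hz => Equiv.swap_apply_of_ne_of_ne
    (by rintro rfl; exact hu hz) (by rintro rfl; exact hv hz)
  have hadj : ∀ x y, H.Adj x y → (H.exchange u v X hu hv).Reachable x y := by
    intro x y hxy
    by_cases hx : x ∈ X
    · refine hsw x y (Adj.reachable ?_)
      show H.Adj _ _
      simp only [hx, if_true, Equiv.swap_apply_self, hzX x hx, ite_self]
      exact hxy
    · by_cases hy : y ∈ X
      · refine (hsw y x (Adj.reachable ?_)).symm
        show H.Adj _ _
        simp only [hy, if_true, Equiv.swap_apply_self, hzX y hy, ite_self]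
        exact hxy.symm
      · refine Adj.reachable ?_
        show H.Adj _ _
        simpa only [hx, hy, if_false] using hxy
  refine ⟨fun x y => ?_⟩
  obtain ⟨p⟩ := hH.preconnected x y
  induction p with
  | nil => exact Reachable.refl _
  | cons h _ ih => exact (hadj _ _ h).trans ih

end Exchange

/-! ### Extremal weights and the two local moves. -/

open scoped Classical in
/-- `f` is a positive weight at which no connected graph with a permuted degree sequence has a
larger quadratic form than `H`, with equality only if the matrices agree on `f`. -/
structure IsExtremalWeight {V : Type*} [Fintype V] (H : SimpleGraph V) (α : ℝ) (f : V → ℝ) :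
    Prop where
  pos : ∀ v, 0 < f v
  le : ∀ H' : SimpleGraph V, H'.Connected →
    (∃ σ : Equiv.Perm V, ∀ x, H'.degree x = H.degree (σ x)) →
    f ⬝ᵥ (generalMatrix H' α).mulVec f ≤ f ⬝ᵥ (generalMatrix H α).mulVec f
  mulVec_eq : ∀ H' : SimpleGraph V, H'.Connected →
    (∃ σ : Equiv.Perm V, ∀ x, H'.degree x = H.degree (σ x)) →
    f ⬝ᵥ (generalMatrix H' α).mulVec f = f ⬝ᵥ (generalMatrix H α).mulVec f →
    (generalMatrix H' α).mulVec f = (generalMatrix H α).mulVec f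

namespace IsExtremalWeight

variable {V : Type*} [Fintype V] {H : SimpleGraph V} {α : ℝ} {f : V → ℝ}

open scoped Classical in
/-- Moving neighbours from `u` to a vertex `v` that then takes over the degree of `u`. -/
theorem lt_of_move (hf : IsExtremalWeight H α f) (hα : 0 ≤ α) (hH : H.Connected) {u v : V}
    (huv : u ≠ v) {S : Finset V} (hS : S.Nonempty) (hvS : v ∉ S) (hSu : ∀ w ∈ S, H.Adj u w)
    (hSv : ∀ w ∈ S, ¬ H.Adj v w) (hcard : H.degree u = H.degree v + S.card)
    (hreach : ∃ p : H.Walk u v, ∀ w ∈ p.support, w ∉ S) : f v < f u := by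
  by_contra! hle
  have huS : u ∉ (S : Set V) := fun h => H.irrefl (hSu u h)
  have hvS' : v ∉ (S : Set V) := hvS
  have hw : ∀ g : V → ℝ, H.exchangeWeight u v S g = ∑ y ∈ S, g y := by
    intro g
    simp only [SimpleGraph.exchangeWeight, Finset.mem_coe, Finset.sum_ite_mem, Finset.univ_inter]
    refine Finset.sum_congr rfl fun y hy => ?_
    rw [SimpleGraph.adjInd_of_adj (hSu y hy), SimpleGraph.adjInd_of_not_adj (hSv y hy)]
    ring
  have hw1 : H.exchangeWeight u v S 1 = S.card := by simp [hw]
  have hpos : 0 < H.exchangeWeight u v S f := by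
    rw [hw]; exact Finset.sum_pos (fun y _ => hf.pos y) hS
  have hconn : (H.exchange u v S huS hvS').Connected := by
    refine hH.exchange H huS hvS' ?_
    obtain ⟨p, hp⟩ := hreach
    clear hcard hle hw hw1 hpos huv
    have : ∀ {x y : V} (p : H.Walk x y), (∀ w ∈ p.support, w ∉ S) →
        (H.exchange u v S huS hvS').Reachable x y := by
      intro x y p
      induction p with
      | nil => exact fun _ => SimpleGraph.Reachable.refl _
      | @cons a b c hab q ih =>
        intro hp
        refine SimpleGraph.Reachable.trans (SimpleGraph.Adj.reachable ?_)
          (ih fun w hw => hp w (by simp [hw]))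
        show H.Adj _ _
        have ha : a ∉ S := hp a (by simp)
        have hb : b ∉ S := hp b (by simp)
        simpa [ha, hb] using hab
    exact this p hp
  have hdeg : ∃ σ : Equiv.Perm V, ∀ x,
      (H.exchange u v S huS hvS').degree x = H.degree (σ x) := by
    refine ⟨Equiv.swap u v, fun x => ?_⟩
    have h := H.degree_exchange huS hvS' huv x
    rw [hw1] at h
    have h' : (H.degree u : ℝ) = H.degree v + S.card := by exact_mod_cast hcard
    have : ((H.exchange u v S huS hvS').degree x : ℝ) = H.degree (Equiv.swap u v x) := by
      rw [h]
      by_cases h1 : x = u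
      · subst h1
        rw [Equiv.swap_apply_left, if_neg huv, if_pos rfl, h']
        ring
      · by_cases h2 : x = v
        · subst h2
          rw [Equiv.swap_apply_right, if_neg h1, if_pos rfl, h']
          ring
        · rw [Equiv.swap_apply_of_ne_of_ne h1 h2, if_neg h1, if_neg h2]
          ring
    exact_mod_cast this
  have hq := H.dotProduct_generalMatrix_exchange huS hvS' huv α f
  have h1 := hf.le _ hconn hdeg
  -- If `f u ≤ f v`, the move does not decrease the form, so extremality forces a tie. But row `v`
  -- has gained the positive weights of `S`, contradicting equal action on `f`.
  have hαk : 0 ≤ α * H.exchangeWeight u v S 1 := by rw [hw1]; positivity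
  have hnn : 0 ≤ (f v - f u) * (2 * H.exchangeWeight u v S f +
      α * H.exchangeWeight u v S 1 * (f v + f u)) :=
    mul_nonneg (by linarith) (add_nonneg (by linarith)
      (mul_nonneg hαk (by linarith [hf.pos u, hf.pos v])))
  have h2 := congrFun (hf.mulVec_eq _ hconn hdeg (by linarith)) v
  rw [H.generalMatrix_exchange_mulVec huS hvS' huv] at h2
  simp only [Finset.mem_coe, hvS, if_false, if_true, Ne.symm huv, sub_zero, one_mul] at h2
  have h3 := mul_nonneg hαk (hf.pos v).le
  linarith

open scoped Classical in
/-- In the path `a - b ⋯ c - d` the two edges `ab`, `cd` may be replaced by `ac`, `bd`; at an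
extremal weight this forces `a, d` to be ordered in the same way as `b, c`. -/
theorem switch (hf : IsExtremalWeight H α f) (hH : H.Connected) {a b c d : V}
    (hbc : b ≠ c) (hab : H.Adj a b) (hcd : H.Adj c d) (hac : ¬ H.Adj a c) (hbd : ¬ H.Adj b d)
    (hreach : ∃ p : H.Walk b c, a ∉ p.support ∧ d ∉ p.support) :
    (f a < f d → f b < f c) ∧ (f a = f d → f b = f c) ∧ (f d < f a → f c < f b) ∧
      (f b = f c → f a = f d) := by
  have hba : b ≠ a := hab.ne'
  have hca : c ≠ a := by rintro rfl; obtain ⟨p, hp, _⟩ := hreach; simp at hp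
  have hbd' : b ≠ d := by rintro rfl; obtain ⟨p, _, hp⟩ := hreach; simp at hp
  have hcd' : c ≠ d := hcd.ne
  have had : a ≠ d := by rintro rfl; exact hac hcd.symm
  have hb : b ∉ ({a, d} : Set V) := by simp [hba, hbd']
  have hc : c ∉ ({a, d} : Set V) := by simp [hca, hcd']
  have hw : ∀ g : V → ℝ, H.exchangeWeight b c {a, d} g = g a - g d := by
    intro g
    rw [SimpleGraph.exchangeWeight, show g a - g d =
      ∑ y, ((if y = a then g a else 0) - (if y = d then g d else 0)) by simp]
    refine Finset.sum_congr rfl fun y _ => ?_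
    by_cases h1 : y = a
    · subst h1
      simp [had, SimpleGraph.adjInd_of_adj hab.symm,
        SimpleGraph.adjInd_of_not_adj (fun h : H.Adj c y => hac h.symm)]
    · by_cases h2 : y = d
      · subst h2
        simp [h1, SimpleGraph.adjInd_of_adj hcd, SimpleGraph.adjInd_of_not_adj hbd]
      · simp [h1, h2]
  have hw1 : H.exchangeWeight b c {a, d} 1 = 0 := by simp [hw]
  have hconn : (H.exchange b c {a, d} hb hc).Connected := by
    refine hH.exchange H hb hc ?_
    obtain ⟨p, hpa, hpd⟩ := hreach
    have : ∀ {x y : V} (p : H.Walk x y), a ∉ p.support → d ∉ p.support →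
        (H.exchange b c {a, d} hb hc).Reachable x y := by
      intro x y p
      induction p with
      | nil => exact fun _ _ => SimpleGraph.Reachable.refl _
      | @cons k l m hkl q ih =>
        intro h1 h2
        simp only [SimpleGraph.Walk.support_cons, List.mem_cons, not_or] at h1 h2
        refine SimpleGraph.Reachable.trans (SimpleGraph.Adj.reachable ?_) (ih h1.2 h2.2)
        show H.Adj _ _
        have hk : k ∉ ({a, d} : Set V) := by simp [Ne.symm h1.1, Ne.symm h2.1]
        have hl : l ∉ ({a, d} : Set V) := by
          have h3 : l ≠ a := by rintro rfl; exact h1.2 q.start_mem_support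
          have h4 : l ≠ d := by rintro rfl; exact h2.2 q.start_mem_support
          simp [h3, h4]
        simpa only [hk, hl, if_false] using hkl
    exact this p hpa hpd
  have hdeg : ∃ σ : Equiv.Perm V, ∀ x,
      (H.exchange b c {a, d} hb hc).degree x = H.degree (σ x) := by
    refine ⟨1, fun x => ?_⟩
    have h := H.degree_exchange hb hc hbc x
    rw [hw1, mul_zero, add_zero] at h
    exact_mod_cast h
  have hq := H.dotProduct_generalMatrix_exchange hb hc hbc α f
  have h1 := hf.le _ hconn hdeg
  rw [hq, hw1, hw f] at h1
  -- In a tie the matrices agree on `f`: row `c` changes by `f a - f d` and row `a` by `f c - f b`,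
  -- so both vanish. This excludes a tie on one side only.
  have h2 : (f c - f b) * (f a - f d) = 0 → f a = f d ∧ f b = f c := by
    intro h0
    have h2 := hf.mulVec_eq _ hconn hdeg (by rw [hq, hw1, hw f]; linear_combination 2 * h0)
    have hC := congrFun h2 c
    have hA := congrFun h2 a
    rw [H.generalMatrix_exchange_mulVec hb hc hbc, hw1, hw f] at hC hA
    simp only [hc, if_false, if_true, Ne.symm hbc] at hC
    simp only [Set.mem_insert_iff, true_or, if_true, Ne.symm hba, Ne.symm hca, if_false,
      SimpleGraph.adjInd_of_adj hab, SimpleGraph.adjInd_of_not_adj hac] at hA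
    constructor <;> linarith
  refine ⟨fun h => ?_, fun h => (h2 (by rw [h]; ring)).2, fun h => ?_,
    fun h => (h2 (by rw [h]; ring)).1⟩
  · by_contra! hcon
    rcases hcon.lt_or_eq with h3 | h3
    · nlinarith [mul_pos (sub_pos.2 h) (sub_pos.2 h3)]
    · linarith [(h2 (by rw [h3]; ring)).1]
  · by_contra! hcon
    rcases hcon.lt_or_eq with h3 | h3
    · nlinarith [mul_pos (sub_pos.2 h) (sub_pos.2 h3)]
    · linarith [(h2 (by rw [h3]; ring)).1]

end IsExtremalWeight

/-! ### Rooted trees via parent maps. -/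

/-- `p` sends every vertex of the tree `H`, rooted at `r`, to its parent. -/
structure IsParentMap {V : Type*} (H : SimpleGraph V) (r : V) (p : V → V) : Prop where
  root : p r = r
  dist_eq : ∀ x, x ≠ r → H.dist x r = H.dist (p x) r + 1
  adj_iff : ∀ x y, H.Adj x y ↔ (x ≠ r ∧ p x = y) ∨ (y ≠ r ∧ p y = x)

theorem SimpleGraph.Connected.exists_adj_dist_succ {V : Type*} {H : SimpleGraph V}
    (hH : H.Connected) {x r : V} (hx : x ≠ r) :
    ∃ y, H.Adj x y ∧ H.dist x r = H.dist y r + 1 := by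
  obtain ⟨q, hq⟩ := hH.exists_walk_length_eq_dist x r
  cases q with
  | nil => exact absurd rfl hx
  | @cons _ y _ h q =>
    refine ⟨y, h, ?_⟩
    have h1 := SimpleGraph.dist_le q
    have h2 := hH.dist_triangle (u := x) (v := y) (w := r)
    rw [SimpleGraph.dist_eq_one_iff_adj.2 h] at h2
    rw [SimpleGraph.Walk.length_cons] at hq
    omega

/-- Joining each non-root vertex to a neighbour nearer the root gives `|V| - 1` distinct edges,
which is all there are. Acyclicity enters only through this count. -/
theorem IsCCyclic.exists_isParentMap {V : Type*} [Fintype V] {H : SimpleGraph V}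
    (hH : IsCCyclic H 0) (r : V) : ∃ p, IsParentMap H r p := by
  classical
  have hex : ∀ x, ∃ y, (x = r → y = r) ∧ (x ≠ r → H.Adj x y ∧ H.dist x r = H.dist y r + 1) := by
    intro x
    by_cases hx : x = r
    · exact ⟨r, fun _ => rfl, fun h => absurd hx h⟩
    · obtain ⟨y, hy⟩ := hH.1.exists_adj_dist_succ hx
      exact ⟨y, fun h => absurd h hx, fun _ => hy⟩
  choose p hp0 hp using hex
  have hinj : Set.InjOn (fun x => s(x, p x)) (Finset.univ.erase r : Finset V) := by
    intro x hx y hy hxy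
    have hx' : x ≠ r := by simpa using hx
    have hy' : y ≠ r := by simpa using hy
    rcases Sym2.eq_iff.1 hxy with h | ⟨h1, h2⟩
    · exact h.1
    · have h3 := (hp x hx').2
      have h4 := (hp y hy').2
      rw [h2] at h3
      rw [← h1] at h4
      omega
  have himg : (Finset.univ.erase r).image (fun x => s(x, p x)) = H.edgeSet.toFinset := by
    refine Finset.eq_of_subset_of_card_le ?_ ?_
    · intro e he
      obtain ⟨x, hx, rfl⟩ := Finset.mem_image.1 he
      rw [Set.mem_toFinset, SimpleGraph.mem_edgeSet]
      exact (hp x (by simpa using hx)).1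
    · rw [Finset.card_image_of_injOn hinj, Finset.card_erase_of_mem (Finset.mem_univ r),
        ← Set.ncard_eq_toFinset_card', Finset.card_univ]
      have := hH.2
      omega
  refine ⟨p, hp0 r rfl, fun x hx => (hp x hx).2, fun x y => ⟨fun h => ?_, ?_⟩⟩
  · have : s(x, y) ∈ (Finset.univ.erase r).image (fun x => s(x, p x)) := by
      rw [himg, Set.mem_toFinset]; exact h
    obtain ⟨z, hz, hzxy⟩ := Finset.mem_image.1 this
    have hz' : z ≠ r := by simpa using hz
    rcases Sym2.eq_iff.1 hzxy with ⟨rfl, h2⟩ | ⟨rfl, h2⟩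
    · exact Or.inl ⟨hz', h2⟩
    · exact Or.inr ⟨hz', h2⟩
  · rintro (⟨h1, rfl⟩ | ⟨h1, rfl⟩)
    · exact (hp x h1).1
    · exact (hp y h1).1.symm

namespace IsParentMap

variable {V : Type*} {H : SimpleGraph V} {r : V} {p : V → V} (hp : IsParentMap H r p)
include hp

theorem adj_parent {x : V} (hx : x ≠ r) : H.Adj x (p x) := (hp.adj_iff _ _).2 (Or.inl ⟨hx, rfl⟩)

theorem ne_root_of_dist_pos {x : V} (hx : 0 < H.dist x r) : x ≠ r := by
  rintro rfl
  simp at hx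

theorem dist_of_adj {x y : V} (h : H.Adj x y) :
    H.dist x r = H.dist y r + 1 ∨ H.dist y r = H.dist x r + 1 := by
  rcases (hp.adj_iff x y).1 h with ⟨h1, rfl⟩ | ⟨h1, rfl⟩
  · exact Or.inl (hp.dist_eq x h1)
  · exact Or.inr (hp.dist_eq y h1)

theorem parent_eq_of_adj {x y : V} (h : H.Adj x y) (hd : H.dist y r = H.dist x r + 1) :
    y ≠ r ∧ p y = x := by
  rcases (hp.adj_iff x y).1 h with ⟨h1, rfl⟩ | h1
  · have := hp.dist_eq x h1
    omega
  · exact h1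

theorem dist_iterate (x : V) (k : ℕ) : H.dist (p^[k] x) r = H.dist x r - k := by
  induction k generalizing x with
  | zero => rfl
  | succ k ih =>
    rw [Function.iterate_succ_apply, ih]
    by_cases hx : x = r
    · subst hx; rw [hp.root]; simp
    · have := hp.dist_eq x hx
      omega

theorem exists_walk_iterate (x : V) (k : ℕ) :
    ∃ w : H.Walk x (p^[k] x), ∀ z ∈ w.support, ∃ j ≤ k, z = p^[j] x := by
  induction k generalizing x with
  | zero => exact ⟨SimpleGraph.Walk.nil, fun z hz => ⟨0, le_rfl, by simpa using hz⟩⟩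
  | succ k ih =>
    by_cases hx : x = r
    · subst hx
      rw [Function.iterate_fixed hp.root]
      exact ⟨SimpleGraph.Walk.nil, fun z hz => ⟨0, by omega, by simpa using hz⟩⟩
    · obtain ⟨w, hw⟩ := ih (p x)
      refine ⟨SimpleGraph.Walk.cons (hp.adj_parent hx) w, fun z hz => ?_⟩
      replace hz : z ∈ x :: w.support := hz
      rcases List.mem_cons.1 hz with rfl | hz
      · exact ⟨0, by omega, rfl⟩
      · obtain ⟨j, hj, rfl⟩ := hw z hz
        exact ⟨j + 1, by omega, rfl⟩

theorem eq_root_of_dist_eq_zero {x : V} (hx : H.dist x r = 0) : x = r := by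
  by_contra h
  have := hp.dist_eq x h
  omega

theorem exists_walk_root (x : V) :
    ∃ w : H.Walk x r, ∀ z ∈ w.support, ∃ j, z = p^[j] x := by
  obtain ⟨w, hw⟩ := hp.exists_walk_iterate x (H.dist x r)
  have h : p^[H.dist x r] x = r := hp.eq_root_of_dist_eq_zero (by rw [hp.dist_iterate]; omega)
  refine ⟨w.copy rfl h, fun z hz => ?_⟩
  rw [SimpleGraph.Walk.support_copy] at hz
  obtain ⟨j, _, hj⟩ := hw z hz
  exact ⟨j, hj⟩

/-- The walk goes from `b` up to the root and down to `c`, meeting only ancestors of `b` or `c`. -/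
theorem exists_walk_avoiding {a b c d : V} (hab : ∀ j, a ≠ p^[j] b) (hac : ∀ j, a ≠ p^[j] c)
    (hdb : ∀ j, d ≠ p^[j] b) (hdc : ∀ j, d ≠ p^[j] c) :
    ∃ w : H.Walk b c, a ∉ w.support ∧ d ∉ w.support := by
  obtain ⟨w1, h1⟩ := hp.exists_walk_root b
  obtain ⟨w2, h2⟩ := hp.exists_walk_root c
  refine ⟨w1.append w2.reverse, ?_, ?_⟩ <;>
    rw [SimpleGraph.Walk.mem_support_append_iff, SimpleGraph.Walk.support_reverse,
      List.mem_reverse, not_or]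
  · exact ⟨fun h => by obtain ⟨j, hj⟩ := h1 _ h; exact hab j hj,
      fun h => by obtain ⟨j, hj⟩ := h2 _ h; exact hac j hj⟩
  · exact ⟨fun h => by obtain ⟨j, hj⟩ := h1 _ h; exact hdb j hj,
      fun h => by obtain ⟨j, hj⟩ := h2 _ h; exact hdc j hj⟩

theorem ne_iterate_of_dist_lt {a b : V} (h : H.dist b r < H.dist a r) (j : ℕ) :
    a ≠ p^[j] b := by
  rintro rfl
  rw [hp.dist_iterate] at h
  omega

end IsParentMap

/-! ### Weights along the layers of an extremal tree. -/

namespace IsExtremalWeight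

variable {V : Type*} [Fintype V] {H : SimpleGraph V} {α : ℝ} {f : V → ℝ}

open scoped Classical in
/-- At an extremal weight of a tree, vertices of larger degree have larger weight. -/
theorem lt_of_degree_lt (hf : IsExtremalWeight H α f) (hα : 0 ≤ α) (hH : IsCCyclic H 0) {u v : V}
    (hd : H.degree v < H.degree u) : f v < f u := by
  have huv : u ≠ v := by rintro rfl; omega
  -- With the root at `v`, the children of `u` lie off the path from `u` to `v`. As `v` has degree
  -- at least 1, `u` has enough children to make up the degree difference.
  obtain ⟨p, hp⟩ := hH.exists_isParentMap v
  have hdv : 0 < H.degree v := by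
    have : Nontrivial V := ⟨⟨u, v, huv⟩⟩
    exact hH.1.preconnected.degree_pos_of_nontrivial v
  have hpu : p u ∈ H.neighborFinset u := by
    rw [SimpleGraph.mem_neighborFinset]; exact hp.adj_parent huv
  have hc : H.degree u - H.degree v ≤ ((H.neighborFinset u).erase (p u)).card := by
    rw [Finset.card_erase_of_mem hpu, SimpleGraph.card_neighborFinset_eq_degree]
    omega
  obtain ⟨S, hS, hcard⟩ := Finset.exists_subset_card_eq hc
  have hS' : ∀ w ∈ S, H.Adj u w ∧ w ≠ v ∧ p w = u := by
    intro w hw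
    have h1 := hS hw
    rw [Finset.mem_erase, SimpleGraph.mem_neighborFinset] at h1
    refine ⟨h1.2, ?_⟩
    rcases (hp.adj_iff u w).1 h1.2 with h2 | h2
    · exact absurd h2.2.symm h1.1
    · exact h2
  refine hf.lt_of_move hα hH.1 huv (S := S) (Finset.card_pos.1 (by omega))
    (fun h => (hS' v h).2.1 rfl) (fun w hw => (hS' w hw).1) (fun w hw h => ?_) (by omega) ?_
  · rcases (hp.adj_iff v w).1 h with h2 | h2
    · exact h2.1 rfl
    · exact huv ((hS' w hw).2.2.symm.trans h2.2)
  · obtain ⟨q, hq⟩ := hp.exists_walk_root u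
    refine ⟨q, fun w hw hwS => ?_⟩
    obtain ⟨j, hj⟩ := hq w hw
    refine hp.ne_iterate_of_dist_lt ?_ j hj
    have := hp.dist_eq w (hS' w hwS).2.1
    rw [(hS' w hwS).2.2] at this
    omega

variable {r : V} {p : V → V}

-- Induction on the depth of the ancestor `z` of `x`. If `f z < f x`, then `x` is no leaf, because
-- `z` is none and smaller degree means smaller weight. For a child `y` of `x`, switching along `p z
-- - z ⋯ x - y` then contradicts `f y ≤ f (p z)`, which is the induction hypothesis.
open scoped Classical in
theorem le_of_iterate_parent (hf : IsExtremalWeight H α f) (hα : 0 ≤ α) (hH : IsCCyclic H 0)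
    (hp : IsParentMap H r p) (hr : ∀ x, f x ≤ f r) :
    ∀ (m : ℕ) (x : V) (k : ℕ), H.dist (p^[k] x) r = m → m < H.dist x r → f x ≤ f (p^[k] x) := by
  intro m
  induction m with
  | zero =>
    intro x k hz _
    rw [hp.eq_root_of_dist_eq_zero hz]
    exact hr x
  | succ m ih =>
    intro x k hz hx
    by_contra! hlt
    obtain ⟨k, rfl⟩ : ∃ l, k = l + 1 := by
      cases k with
      | zero => simp at hz; omega
      | succ l => exact ⟨l, rfl⟩
    have hzr : p^[k + 1] x ≠ r := hp.ne_root_of_dist_pos (by omega)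
    have hxr : x ≠ r := hp.ne_root_of_dist_pos (by omega)
    have hpz := hp.dist_eq _ hzr
    have hcz := hp.dist_iterate x k
    have hcz' := hp.dist_iterate x (k + 1)
    have hcr : p^[k] x ≠ r := hp.ne_root_of_dist_pos (by omega)
    have hadjc : H.Adj (p^[k + 1] x) (p^[k] x) := by
      rw [Function.iterate_succ_apply']; exact (hp.adj_parent hcr).symm
    have hdz : 1 < H.degree (p^[k + 1] x) := by
      rw [← SimpleGraph.card_neighborFinset_eq_degree, Finset.one_lt_card]
      refine ⟨p (p^[k + 1] x), ?_, p^[k] x, ?_, fun h => ?_⟩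
      · rw [SimpleGraph.mem_neighborFinset]; exact hp.adj_parent hzr
      · rw [SimpleGraph.mem_neighborFinset]; exact hadjc
      · rw [h] at hpz; omega
    have hdx : 1 < H.degree x := by
      by_contra! hcon
      exact absurd (hf.lt_of_degree_lt hα hH (u := p^[k + 1] x) (v := x) (by omega)) (by linarith)
    rw [← SimpleGraph.card_neighborFinset_eq_degree] at hdx
    obtain ⟨y, hy, hyp⟩ := Finset.exists_mem_ne hdx (p x)
    rw [SimpleGraph.mem_neighborFinset] at hy
    obtain ⟨hyr, hpy⟩ : y ≠ r ∧ p y = x := by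
      rcases (hp.adj_iff x y).1 hy with h | h
      · exact absurd h.2.symm hyp
      · exact h
    have hdy := hp.dist_eq y hyr
    rw [hpy] at hdy
    have hsw := hf.switch hH.1 (a := p (p^[k + 1] x)) (b := p^[k + 1] x) (c := x) (d := y)
      (fun h => by rw [h] at hz; omega) (hp.adj_parent hzr).symm hy
      (fun h => by have := hp.dist_of_adj h; omega)
      (fun h => by have := hp.dist_of_adj h; omega) (by
        obtain ⟨w, hw⟩ := hp.exists_walk_iterate x (k + 1)
        refine ⟨w.reverse, ?_, ?_⟩ <;>
          rw [SimpleGraph.Walk.support_reverse, List.mem_reverse] <;> intro hmem <;>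
          obtain ⟨j, hj, he⟩ := hw _ hmem
        · have := hp.dist_iterate x j
          rw [← he] at this
          omega
        · have := hp.dist_iterate x j
          rw [← he] at this
          omega)
    -- One step leads from `y` to `x`, then `k + 1` to `z` and one more to `p z`.
    have hle := ih y (k + 3) (by
      rw [Function.iterate_succ_apply, hpy, Function.iterate_succ_apply']; omega) (by omega)
    rw [Function.iterate_succ_apply, hpy, Function.iterate_succ_apply'] at hle
    rcases hle.lt_or_eq with h | h
    · linarith [hsw.2.2.1 h]
    · linarith [hsw.2.1 h.symm]

/-- At an extremal weight of a tree the weights decrease from layer to layer. -/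
theorem le_of_dist_lt (hf : IsExtremalWeight H α f) (hα : 0 ≤ α) (hH : IsCCyclic H 0)
    (hp : IsParentMap H r p) (hr : ∀ x, f x ≤ f r) {u v : V} (huv : H.dist u r < H.dist v r) :
    f v ≤ f u := by
  obtain ⟨m, hm⟩ : ∃ m, H.dist u r = m := ⟨_, rfl⟩
  induction m generalizing u v with
  | zero => rw [hp.eq_root_of_dist_eq_zero hm]; exact hr v
  | succ m ih =>
    -- The switch on `u - p u ⋯ p v - v` needs a middle walk avoiding `u` and `u` not adjacent to `p
    -- v`; both may fail when `u` is an ancestor of `v`.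
    by_cases hanc : ∃ k, u = p^[k] v
    · obtain ⟨k, rfl⟩ := hanc
      exact hf.le_of_iterate_parent hα hH hp hr _ v k rfl huv
    push Not at hanc
    by_contra! hlt
    have hur : u ≠ r := hp.ne_root_of_dist_pos (by omega)
    have hvr : v ≠ r := hp.ne_root_of_dist_pos (by omega)
    have hu := hp.dist_eq u hur
    have hv := hp.dist_eq v hvr
    have hsw := hf.switch hH.1 (a := u) (b := p u) (c := p v) (d := v)
      (fun h => by rw [h] at hu; omega) (hp.adj_parent hur) (hp.adj_parent hvr).symm
      (fun h => by
        rcases (hp.adj_iff _ _).1 h with h1 | h1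
        · have := h1.2; rw [this] at hu; omega
        · exact hanc 2 h1.2.symm)
      (fun h => by have := hp.dist_of_adj h; omega)
      (hp.exists_walk_avoiding (hp.ne_iterate_of_dist_lt (by omega)) (fun j => hanc (j + 1))
        (hp.ne_iterate_of_dist_lt (by omega)) (hp.ne_iterate_of_dist_lt (by omega)))
    have := ih (u := p u) (v := p v) (by omega) (by omega)
    linarith [hsw.1 hlt]

/-- The switch on `v - p v ⋯ p y - y`, read backwards by trichotomy. The tie clause is needed
because distinct parents may have equal weight. -/
theorem children_order (hf : IsExtremalWeight H α f) (hH : IsCCyclic H 0)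
    (hp : IsParentMap H r p) {v y : V} (hv : v ≠ r) (hy : y ≠ r) (hvy : p v ≠ p y)
    (hd : H.dist v r = H.dist y r) :
    (f (p v) < f (p y) → f v < f y) ∧ (f (p v) = f (p y) → f v = f y) := by
  have h1 := hp.dist_eq v hv
  have h2 := hp.dist_eq y hy
  have hsw := hf.switch hH.1 (a := v) (b := p v) (c := p y) (d := y) hvy (hp.adj_parent hv)
    (hp.adj_parent hy).symm
    (fun h => by
      rcases (hp.adj_iff _ _).1 h with h3 | h3
      · exact hvy h3.2
      · have := hp.dist_eq _ h3.1
        rw [h3.2] at this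
        omega)
    (fun h => by
      rcases (hp.adj_iff _ _).1 h with h3 | h3
      · have := hp.dist_eq _ h3.1
        rw [h3.2] at this
        omega
      · exact hvy h3.2.symm)
    (hp.exists_walk_avoiding (hp.ne_iterate_of_dist_lt (by omega))
      (hp.ne_iterate_of_dist_lt (by omega)) (hp.ne_iterate_of_dist_lt (by omega))
      (hp.ne_iterate_of_dist_lt (by omega)))
  refine ⟨fun h => ?_, hsw.2.2.2⟩
  by_contra! hle
  rcases hle.lt_or_eq with h3 | h3
  · linarith [hsw.2.2.1 h3]
  · linarith [hsw.2.1 h3.symm]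

end IsExtremalWeight

/-! ### Constructing a BFS-ordering from an extremal weight. -/

theorem exists_equiv_monotone_comp {V β : Type*} [Fintype V] [LinearOrder β] {N : ℕ}
    (hN : Fintype.card V = N) (F : V → β) : ∃ e : Fin N ≃ V, Monotone (F ∘ e) := by
  let e₀ : Fin N ≃ V := (Fintype.equivFinOfCardEq hN).symm
  exact ⟨(Tuple.sort (F ∘ e₀)).trans e₀, Tuple.monotone_sort (F ∘ e₀)⟩

/-- A numerical key that sorts the vertices of a rooted tree by layer, then by the key of the
parent, then by `g`. -/
theorem IsParentMap.exists_key {V : Type*} {H : SimpleGraph V} {r : V} {p : V → V}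
    (hp : IsParentMap H r p) (g : V → ℕ) (N : ℕ) :
    ∃ κ : V → ℕ, κ r = 1 ∧ ∀ v, v ≠ r → κ v = κ (p v) * N + g v := by
  refine ⟨fun v => Nat.rec (motive := fun _ => V → ℕ) (fun _ => 1)
    (fun _ K v => K (p v) * N + g v) (H.dist v r) v, ?_, ?_⟩
  · simp
  · intro v hv
    simp only [hp.dist_eq v hv]

open scoped Classical in
/-- A tree with an extremal weight has a BFS-ordering. -/
theorem IsExtremalWeight.exists_isBFSOrdering {V : Type*} [Fintype V] {H : SimpleGraph V} {α : ℝ}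
    {f : V → ℝ} (hf : IsExtremalWeight H α f) (hα : 0 ≤ α) (hH : IsCCyclic H 0) :
    ∃ (m : ℕ) (e : Fin (m + 1) ≃ V), IsBFSOrdering H e := by
  have := hH.1.nonempty
  obtain ⟨r, hr⟩ := Finite.exists_max f
  obtain ⟨p, hp⟩ := hH.exists_isParentMap r
  obtain ⟨s, hs⟩ := exists_equiv_monotone_comp rfl (fun v => -f v)
  -- `g` is the rank by decreasing weight, with ties broken. Read in base `N`, the key `κ v` has
  -- last digit `g v` and the parent's key in front. The `+ 1` in `N` secures `N ≥ 2`, so non-root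
  -- keys exceed 1.
  let g : V → ℕ := fun v => s.symm v
  let N := Fintype.card V + 1
  have hgN : ∀ v, g v < N := fun v => (s.symm v).isLt.trans (Nat.lt_succ_self _)
  have hN : 2 ≤ N := by have := Fintype.card_pos (α := V); omega
  have hg_inj : ∀ v w, g v = g w → v = w := fun v w h => s.symm.injective (Fin.ext h)
  have hg : ∀ v w, g v ≤ g w → f w ≤ f v := by
    intro v w h
    have := hs (a := s.symm v) (b := s.symm w) h
    simpa using this
  obtain ⟨κ, hκr, hκ⟩ := hp.exists_key g N
  have hκpos : ∀ v, 1 ≤ κ v ∧ (v ≠ r → 1 < κ v) := by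
    intro v
    obtain ⟨m, hm⟩ : ∃ m, H.dist v r = m := ⟨_, rfl⟩
    induction m generalizing v with
    | zero =>
      have := hp.eq_root_of_dist_eq_zero hm
      exact ⟨by rw [this, hκr], fun h => absurd this h⟩
    | succ m ih =>
      have hv : v ≠ r := hp.ne_root_of_dist_pos (by omega)
      have h1 := (ih (p v) (by have := hp.dist_eq v hv; omega)).1
      have h2 := hκ v hv
      have h3 : 1 * 2 ≤ κ (p v) * N := Nat.mul_le_mul h1 hN
      exact ⟨by omega, fun _ => by omega⟩
  have hmod : ∀ v, v ≠ r → κ v % N = g v ∧ κ v / N = κ (p v) := by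
    intro v hv
    rw [hκ v hv]
    constructor
    · rw [mul_comm, Nat.mul_add_mod, Nat.mod_eq_of_lt (hgN v)]
    · rw [mul_comm, Nat.mul_add_div (by omega), Nat.div_eq_of_lt (hgN v), add_zero]
  have hκ_inj : Function.Injective κ := by
    intro v w h
    by_cases hv : v = r <;> by_cases hw : w = r
    · rw [hv, hw]
    · have := (hκpos w).2 hw; rw [hv, hκr] at h; omega
    · have := (hκpos v).2 hv; rw [hw, hκr] at h; omega
    · exact hg_inj v w (by rw [← (hmod v hv).1, h, (hmod w hw).1])
  have hchild : ∀ v y, v ≠ r → y ≠ r → κ (p v) < κ (p y) → κ v < κ y := by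
    intro v y hv hy h
    by_contra! hle
    have := Nat.div_le_div_right (c := N) hle
    rw [(hmod v hv).2, (hmod y hy).2] at this
    omega
  have hlayer : ∀ m u v, H.dist u r = m → H.dist u r < H.dist v r → κ u < κ v := by
    intro m
    induction m with
    | zero =>
      intro u v hu huv
      rw [hp.eq_root_of_dist_eq_zero hu, hκr]
      exact (hκpos v).2 (hp.ne_root_of_dist_pos (by omega))
    | succ m ih =>
      intro u v hu huv
      have hur : u ≠ r := hp.ne_root_of_dist_pos (by omega)
      have hvr : v ≠ r := hp.ne_root_of_dist_pos (by omega)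
      have h1 := hp.dist_eq u hur
      have h2 := hp.dist_eq v hvr
      exact hchild u v hur hvr (ih _ _ (by omega) (by omega))
  have hdist : ∀ u v, κ u ≤ κ v → H.dist u r ≤ H.dist v r := by
    intro u v h
    by_contra! hlt
    have := hlayer _ v u rfl hlt
    omega
  -- Key order refines weight order: different layers by `le_of_dist_lt`, siblings by rank, and
  -- other pairs in a layer by induction on their parents.
  have hweight : ∀ m u v, H.dist u r = m → κ u < κ v → f v ≤ f u := by
    intro m
    induction m with
    | zero => intro u v hu _; rw [hp.eq_root_of_dist_eq_zero hu]; exact hr v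
    | succ m ih =>
      intro u v hu huv
      rcases (hdist u v huv.le).lt_or_eq with h | h
      · exact hf.le_of_dist_lt hα hH hp hr h
      · have hur : u ≠ r := hp.ne_root_of_dist_pos (by omega)
        have hvr : v ≠ r := hp.ne_root_of_dist_pos (by omega)
        have h1 := hp.dist_eq u hur
        by_cases hpp : p u = p v
        · have h2 := hκ u hur
          have h3 := hκ v hvr
          rw [hpp] at h2
          exact hg u v (by omega)
        · have hlt : κ (p u) < κ (p v) := by
            by_contra! hle
            rcases hle.lt_or_eq with h4 | h4
            · have := hchild v u hvr hur h4
              omega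
            · exact hpp (hκ_inj h4.symm)
          have hco := hf.children_order hH hp hvr hur (Ne.symm hpp) h.symm
          rcases (ih (p u) (p v) (by omega) hlt).lt_or_eq with h4 | h4
          · exact (hco.1 h4).le
          · exact (hco.2 h4).le
  obtain ⟨m, hm⟩ : ∃ m, Fintype.card V = m + 1 := ⟨Fintype.card V - 1, by omega⟩
  obtain ⟨e, he⟩ := exists_equiv_monotone_comp hm κ
  have hlt : ∀ i j, κ (e i) < κ (e j) → i < j := fun i j h => by
    by_contra! hle
    have := he hle
    simp only [Function.comp_apply] at this
    omega
  have he0 : e 0 = r := by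
    by_contra h
    have h1 := (hκpos (e 0)).2 h
    have h2 := he (Fin.zero_le (e.symm r))
    simp only [Function.comp_apply, Equiv.apply_symm_apply, hκr] at h2
    omega
  have hsymm : ∀ u v, e.symm u < e.symm v ↔ κ u < κ v := by
    intro u v
    constructor
    · intro h
      have h1 := he h.le
      simp only [Function.comp_apply, Equiv.apply_symm_apply] at h1
      refine lt_of_le_of_ne h1 fun h2 => ?_
      rw [hκ_inj h2] at h
      exact lt_irrefl _ h
    · intro h
      exact hlt _ _ (by simpa using h)
  refine ⟨m, e, ?_, ?_, ?_⟩
  · intro i j hij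
    by_contra! hdeg
    have h1 := hf.lt_of_degree_lt hα hH hdeg
    rcases (show κ (e i) ≤ κ (e j) from he hij).lt_or_eq with h2 | h2
    · linarith [hweight _ _ _ rfl h2]
    · rw [hκ_inj h2] at h1
      exact lt_irrefl _ h1
  · intro i j hij
    rw [he0]
    exact hdist _ _ (he hij)
  · intro u x v y hv hy hux hvu hyu hlt'
    rw [he0] at hux hvu hyu
    obtain ⟨hvr, hpv⟩ := hp.parent_eq_of_adj hv.1 hvu
    obtain ⟨hyr, hpy⟩ := hp.parent_eq_of_adj hy.1 (by rw [hyu, hux])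
    rw [hsymm] at hlt' ⊢
    refine hchild v y hvr hyr ?_
    rwa [hpv, hpy]

/-! ### A BFS-ordered tree is determined by its degrees. -/

theorem antitone_comp_equiv_unique {V : Type*} {N : ℕ} (d : V → ℕ) (e v : Fin N ≃ V)
    (he : Antitone (d ∘ e)) (hv : Antitone (d ∘ v)) : d ∘ e = d ∘ v := by
  have h := Tuple.unique_monotone (f := OrderDual.toDual ∘ d ∘ v) (σ := e.trans v.symm)
    (τ := Equiv.refl _) (fun i j hij => by simpa using he hij)
    (fun i j hij => by simpa using hv hij)
  funext i
  simpa using congrFun h i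

theorem Fin.mem_iff_lt_card_of_isLowerSet {N : ℕ} {S : Finset (Fin N)}
    (hS : ∀ j k, j ≤ k → k ∈ S → j ∈ S) (k : Fin N) : k ∈ S ↔ (k : ℕ) < S.card := by
  constructor
  · intro hk
    have h : Finset.Iic k ⊆ S := fun j hj => hS j k (Finset.mem_Iic.1 hj) hk
    have := Finset.card_le_card h
    rw [Fin.card_Iic] at this
    omega
  · intro hk
    by_contra hkS
    have h : S ⊆ Finset.Iio k := fun j hj => by
      rw [Finset.mem_Iio]
      by_contra! hle
      exact hkS (hS k j hle hj)
    have := Finset.card_le_card h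
    rw [Fin.card_Iio] at this
    omega

/-- In a sequence of parents that is monotone, the children of `i` occupy the positions prescribed
by breadth-first search. -/
theorem parent_eq_iff_bfsFirstChild {m : ℕ} (δ : Fin (m + 1) → ℕ)
    (q : Fin (m + 1) → Fin (m + 1)) (hmono : ∀ j k, j ≠ 0 → j ≤ k → q j ≤ q k)
    (hcard : ∀ i, (Finset.univ.filter fun k => k ≠ 0 ∧ q k = i).card = bfsChildCount δ i)
    (i k : Fin (m + 1)) : (k ≠ 0 ∧ q k = i) ↔
      bfsFirstChild δ i ≤ (k : ℕ) ∧ (k : ℕ) < bfsFirstChild δ i + bfsChildCount δ i := by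
  classical
  -- Monotonicity makes `B i` and `B' i` initial segments; their sizes are the two ends of the block
  -- of children of `i`. The root has no parent and is counted by hand.
  let B : Fin (m + 1) → Finset (Fin (m + 1)) := fun i => Finset.univ.filter fun k => k = 0 ∨ q k < i
  let B' : Fin (m + 1) → Finset (Fin (m + 1)) := fun i => Finset.univ.filter fun k => k = 0 ∨ q k ≤ i
  have hB : ∀ i k, k ∈ B i ↔ (k : ℕ) < (B i).card := by
    refine fun i k => Fin.mem_iff_lt_card_of_isLowerSet (fun j k hjk hk => ?_) k
    simp only [B, Finset.mem_filter, Finset.mem_univ, true_and] at hk ⊢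
    by_cases hj : j = 0
    · exact Or.inl hj
    · rcases hk with rfl | hk
      · exact absurd (Fin.le_zero_iff.1 hjk) hj
      · exact Or.inr ((hmono j k hj hjk).trans_lt hk)
  have hB' : ∀ i k, k ∈ B' i ↔ (k : ℕ) < (B' i).card := by
    refine fun i k => Fin.mem_iff_lt_card_of_isLowerSet (fun j k hjk hk => ?_) k
    simp only [B', Finset.mem_filter, Finset.mem_univ, true_and] at hk ⊢
    by_cases hj : j = 0
    · exact Or.inl hj
    · rcases hk with rfl | hk
      · exact absurd (Fin.le_zero_iff.1 hjk) hj
      · exact Or.inr ((hmono j k hj hjk).trans hk)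
  have hcB : ∀ i, (B i).card = bfsFirstChild δ i := by
    intro i
    have h1 : B i = insert 0 (Finset.univ.filter fun k => k ≠ 0 ∧ q k < i) := by
      ext k
      simp only [B, Finset.mem_filter, Finset.mem_univ, true_and, Finset.mem_insert]
      tauto
    rw [h1, Finset.card_insert_of_notMem (by simp), bfsFirstChild, add_comm]
    congr 1
    rw [Finset.card_eq_sum_card_fiberwise (f := q) (t := Finset.Iio i)
      (fun k hk => by simpa using (Finset.mem_filter.1 hk).2.2)]
    refine Finset.sum_congr rfl fun j hj => ?_
    rw [← hcard j]
    congr 1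
    ext k
    simp only [Finset.mem_filter, Finset.mem_univ, true_and]
    constructor
    · exact fun h => ⟨h.1.1, h.2⟩
    · rintro ⟨h1, rfl⟩
      exact ⟨⟨h1, Finset.mem_Iio.1 hj⟩, rfl⟩
  have hcB' : (B' i).card = bfsFirstChild δ i + bfsChildCount δ i := by
    rw [← hcB, ← hcard, ← Finset.card_union_of_disjoint]
    · congr 1
      ext k
      simp only [B, B', Finset.mem_filter, Finset.mem_univ, true_and, Finset.mem_union,
        le_iff_lt_or_eq]
      tauto
    · rw [Finset.disjoint_left]
      intro k hk
      simp only [B, Finset.mem_filter, Finset.mem_univ, true_and] at hk ⊢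
      rintro ⟨h1, rfl⟩
      exact hk.elim h1 (lt_irrefl _)
  have h1 := hB i k
  have h2 := hB' i k
  rw [hcB] at h1
  rw [hcB'] at h2
  rw [← h2, ← not_lt, ← h1]
  simp only [B, B', Finset.mem_filter, Finset.mem_univ, true_and, not_or, not_lt]
  constructor
  · rintro ⟨h, rfl⟩
    exact ⟨⟨h, le_rfl⟩, Or.inr le_rfl⟩
  · rintro ⟨⟨h, h3⟩, h4⟩
    exact ⟨h, le_antisymm (h4.resolve_left h) h3⟩

open scoped Classical in
theorem IsBFSOrdering.nonempty_iso_bfsTree_aux {V : Type*} [Fintype V] {T : SimpleGraph V}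
    (hT : IsCCyclic T 0) {m : ℕ} {e : Fin (m + 1) ≃ V} (he : IsBFSOrdering T e)
    (δ : Fin (m + 1) → ℕ) (hδ : ∀ i, T.degree (e i) = δ i) : Nonempty (T ≃g bfsTree δ) := by
  obtain ⟨p, hp⟩ := hT.exists_isParentMap (e 0)
  let q : Fin (m + 1) → Fin (m + 1) := fun k => e.symm (p (e k))
  have hq : ∀ k, e (q k) = p (e k) := fun k => e.apply_symm_apply _
  have hne : ∀ {k}, k ≠ 0 → e k ≠ e 0 := fun hk h => hk (e.injective h)
  have hdist : ∀ {i j}, T.dist (e i) (e 0) < T.dist (e j) (e 0) → i < j := by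
    intro i j h
    by_contra! hle
    have := he.dist_monotone _ _ hle
    omega
  have hmono : ∀ j k, j ≠ 0 → j ≤ k → q j ≤ q k := by
    intro j k hj hjk
    have hk : k ≠ 0 := by rintro rfl; exact hj (Fin.le_zero_iff.1 hjk)
    by_contra! hlt
    have h1 := hp.dist_eq _ (hne hj)
    have h2 := hp.dist_eq _ (hne hk)
    -- If parents were reversed, monotone distances would squeeze both parents into one layer and
    -- both children into the next, where `next_layer` puts `k` before `j`.
    have h3 := he.dist_monotone _ _ hlt.le
    have h4 := he.dist_monotone _ _ hjk
    rw [hq, hq] at h3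
    have hpp : p (e j) ≠ p (e k) := fun h => hlt.ne' (congrArg e.symm h)
    have hnadj : ∀ {a b}, a ≠ e 0 → p a ≠ p b → T.dist a (e 0) = T.dist (p b) (e 0) + 1 →
        ¬ T.Adj (p b) a := by
      intro a b ha hab hd hadj
      exact hab (hp.parent_eq_of_adj hadj hd).2
    have h5 := he.next_layer (p (e k)) (p (e j)) (e k) (e j)
      ⟨(hp.adj_parent (hne hk)).symm, hnadj (hne hk) (Ne.symm hpp) (by omega)⟩
      ⟨(hp.adj_parent (hne hj)).symm, hnadj (hne hj) hpp (by omega)⟩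
      (by omega) (by omega) (by omega) hlt
    rw [e.symm_apply_apply, e.symm_apply_apply] at h5
    exact absurd hjk (not_le.2 h5)
  have hadj : ∀ i k, T.Adj (e i) (e k) ↔ (i ≠ 0 ∧ q i = k) ∨ (k ≠ 0 ∧ q k = i) := by
    intro i k
    rw [hp.adj_iff]
    simp only [q, ne_eq, e.injective.eq_iff, Equiv.symm_apply_eq]
  have hcard : ∀ i, (Finset.univ.filter fun k => k ≠ 0 ∧ q k = i).card = bfsChildCount δ i := by
    intro i
    have hsub : (Finset.univ.filter fun k => T.Adj (e i) (e k)).card = δ i := by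
      rw [← hδ, ← SimpleGraph.card_neighborFinset_eq_degree]
      refine Finset.card_bij (fun k _ => e k) ?_ (fun _ _ _ _ h => e.injective h) ?_
      · intro k hk
        simpa using hk
      · intro v hv
        exact ⟨e.symm v, by simpa using hv, by simp⟩
    unfold bfsChildCount
    split_ifs with hi
    · have hi0 : i = 0 := Fin.ext hi
      rw [← hsub]
      congr 1
      ext k
      simp [hadj, hi0]
    · have hi0 : i ≠ 0 := fun h => hi (by rw [h]; rfl)
      have hins : (Finset.univ.filter fun k => T.Adj (e i) (e k)) =
          insert (q i) (Finset.univ.filter fun k => k ≠ 0 ∧ q k = i) := by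
        ext k
        simp only [hadj, Finset.mem_filter, Finset.mem_univ, true_and, Finset.mem_insert, hi0,
          ne_eq, not_false_eq_true, eq_comm (a := k) (b := q i)]
      rw [← hsub, hins, Finset.card_insert_of_notMem]
      · rfl
      · simp only [Finset.mem_filter, Finset.mem_univ, true_and, not_and]
        intro h0 h
        have h1 := hp.dist_eq _ (hne hi0)
        have h2 := hp.dist_eq _ (hne h0)
        rw [← hq, h] at h2
        rw [← hq] at h1
        omega
  have hiff := parent_eq_iff_bfsFirstChild δ q hmono hcard
  refine ⟨e.symm, fun {a b} => ?_⟩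
  obtain ⟨i, rfl⟩ := e.surjective a
  obtain ⟨k, rfl⟩ := e.surjective b
  show (bfsTree δ).Adj (e.symm (e i)) (e.symm (e k)) ↔ _
  rw [e.symm_apply_apply, e.symm_apply_apply, bfsTree, SimpleGraph.fromRel_adj, hadj, ← hiff,
    ← hiff, or_comm, and_iff_right_of_imp]
  intro h hik
  have h2 : T.Adj (e i) (e k) := (hadj i k).2 h
  rw [hik] at h2
  exact T.irrefl h2

open scoped Classical in
/-- A tree with a BFS-ordering is determined by its degree sequence. -/
theorem nonempty_iso_bfsTree {V : Type*} [Fintype V] {T : SimpleGraph V} (hT : IsCCyclic T 0)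
    (hbfs : ∃ (m : ℕ) (e : Fin (m + 1) ≃ V), IsBFSOrdering T e) {N : ℕ} {δ : Fin N → ℕ}
    (hmono : Antitone δ) (hδ : HasDegreeSequence T δ) : Nonempty (T ≃g bfsTree δ) := by
  obtain ⟨m, e, he⟩ := hbfs
  obtain ⟨v, hv⟩ := hδ
  obtain rfl : N = m + 1 := by
    have h1 := Fintype.card_congr e
    have h2 := Fintype.card_congr v
    rw [Fintype.card_fin] at h1 h2
    omega
  have h := antitone_comp_equiv_unique (fun x => T.degree x) e v
    (fun i j hij => he.degree_antitone i j hij)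
    (fun i j hij => by
      have := hmono hij
      rw [← hv, ← hv] at this
      exact this)
  exact he.nonempty_iso_bfsTree_aux hT δ fun i => (congrFun h i).trans (hv i)

/-! ### Joins and the extremality of the restricted Perron vector. -/

section Join

variable {V W : Type*} (G : SimpleGraph V) (H : SimpleGraph W)

@[simp] theorem graphJoin_adj_inl_inl (i j : V) :
    (graphJoin G H).Adj (Sum.inl i) (Sum.inl j) ↔ G.Adj i j := by
  simp [graphJoin]

@[simp] theorem graphJoin_adj_inr_inr (i j : W) :
    (graphJoin G H).Adj (Sum.inr i) (Sum.inr j) ↔ H.Adj i j := by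
  simp [graphJoin]

@[simp] theorem graphJoin_adj_inl_inr (i : V) (j : W) :
    (graphJoin G H).Adj (Sum.inl i) (Sum.inr j) := by
  simp [graphJoin]

@[simp] theorem graphJoin_adj_inr_inl (i : V) (j : W) :
    (graphJoin G H).Adj (Sum.inr j) (Sum.inl i) := by
  simp [graphJoin]

/-- Isomorphic graphs have isomorphic joins with `G`. -/
def graphJoinCongrRight {W' : Type*} {H : SimpleGraph W} {H' : SimpleGraph W'} (e : H ≃g H') :
    graphJoin G H ≃g graphJoin G H' where
  toEquiv := Equiv.sumCongr (Equiv.refl V) e.toEquiv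
  map_rel_iff' {a b} := by
    rcases a with a | a <;> rcases b with b | b
    · simp
    · simp
    · simp
    · show (graphJoin G H').Adj (Sum.inr (e a)) (Sum.inr (e b)) ↔ _
      rw [graphJoin_adj_inr_inr, graphJoin_adj_inr_inr, e.map_adj_iff]

theorem graphJoin_connected (hH : H.Connected) : (graphJoin G H).Connected := by
  have := hH.nonempty
  let w₀ : W := Classical.arbitrary W
  have hr : ∀ w, (graphJoin G H).Reachable (Sum.inr w) (Sum.inr w₀) := fun w =>
    (hH.preconnected w w₀).map
      (⟨Sum.inr, fun h => (graphJoin_adj_inr_inr G H _ _).2 h⟩ : H →g graphJoin G H)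
  have h : ∀ x, (graphJoin G H).Reachable x (Sum.inr w₀) := by
    rintro (i | w)
    · exact (graphJoin_adj_inl_inr G H i w₀).reachable
    · exact hr w
  have : Nonempty (V ⊕ W) := ⟨Sum.inr w₀⟩
  exact ⟨fun x y => (h x).trans (h y).symm⟩

@[simp] theorem graphJoin_adjInd_inl_inl (i j : V) :
    (graphJoin G H).adjInd (Sum.inl i) (Sum.inl j) = G.adjInd i j := by
  unfold SimpleGraph.adjInd
  congr 1
  exact propext (graphJoin_adj_inl_inl G H i j)

@[simp] theorem graphJoin_adjInd_inr_inr (i j : W) :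
    (graphJoin G H).adjInd (Sum.inr i) (Sum.inr j) = H.adjInd i j := by
  unfold SimpleGraph.adjInd
  congr 1
  exact propext (graphJoin_adj_inr_inr G H i j)

@[simp] theorem graphJoin_adjInd_inl_inr (i : V) (j : W) :
    (graphJoin G H).adjInd (Sum.inl i) (Sum.inr j) = 1 :=
  SimpleGraph.adjInd_of_adj (graphJoin_adj_inl_inr G H i j)

@[simp] theorem graphJoin_adjInd_inr_inl (i : V) (j : W) :
    (graphJoin G H).adjInd (Sum.inr j) (Sum.inl i) = 1 :=
  SimpleGraph.adjInd_of_adj (graphJoin_adj_inr_inl G H i j)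

variable [Fintype V] [Fintype W]

open scoped Classical in
theorem graphJoin_degree_inl (i : V) :
    (graphJoin G H).degree (Sum.inl i) = G.degree i + Fintype.card W := by
  have : ((graphJoin G H).degree (Sum.inl i) : ℝ) = G.degree i + Fintype.card W := by
    rw [SimpleGraph.degree_eq_sum_adjInd, SimpleGraph.degree_eq_sum_adjInd, Fintype.sum_sum_type]
    simp
  exact_mod_cast this

open scoped Classical in
theorem graphJoin_degree_inr (w : W) :
    (graphJoin G H).degree (Sum.inr w) = Fintype.card V + H.degree w := by
  have : ((graphJoin G H).degree (Sum.inr w) : ℝ) = Fintype.card V + H.degree w := by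
    rw [SimpleGraph.degree_eq_sum_adjInd, SimpleGraph.degree_eq_sum_adjInd, Fintype.sum_sum_type]
    simp
  exact_mod_cast this

/-- The right-hand side does not involve `H`. In the companion formula for `Sum.inr`, `H` enters
only through its own matrix, so two joins with `G` can be compared on `W` alone. -/
theorem generalMatrix_graphJoin_mulVec_inl (α : ℝ) (f : V ⊕ W → ℝ) (i : V) :
    (generalMatrix (graphJoin G H) α).mulVec f (Sum.inl i) =
      (generalMatrix G α).mulVec (f ∘ Sum.inl) i + ∑ w, f (Sum.inr w) +
        α * (Fintype.card W * f (Sum.inl i)) := by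
  simp only [generalMatrix_mulVec_eq_adjInd, Fintype.sum_sum_type, graphJoin_adjInd_inl_inl,
    graphJoin_adjInd_inl_inr, Finset.sum_const, Finset.card_univ, nsmul_eq_mul,
    Function.comp_apply, one_mul, mul_one]
  ring

theorem generalMatrix_graphJoin_mulVec_inr (α : ℝ) (f : V ⊕ W → ℝ) (w : W) :
    (generalMatrix (graphJoin G H) α).mulVec f (Sum.inr w) =
      (generalMatrix H α).mulVec (f ∘ Sum.inr) w + ∑ i, f (Sum.inl i) +
        α * (Fintype.card V * f (Sum.inr w)) := by
  simp only [generalMatrix_mulVec_eq_adjInd, Fintype.sum_sum_type, graphJoin_adjInd_inr_inr,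
    graphJoin_adjInd_inr_inl, Finset.sum_const, Finset.card_univ, nsmul_eq_mul,
    Function.comp_apply, one_mul, mul_one]
  ring

open scoped Classical in
/-- If `G ∨ H` has the largest spectral radius among the joins of `G` with connected graphs of
permuted degrees, then the Perron vector of `G ∨ H` is extremal for `H`. -/
theorem exists_isExtremalWeight (α : ℝ) (hH : H.Connected)
    (hmax : ∀ H' : SimpleGraph W, H'.Connected →
      (∃ σ : Equiv.Perm W, ∀ x, H'.degree x = H.degree (σ x)) →
      generalSpectralRadius (graphJoin G H') α ≤ generalSpectralRadius (graphJoin G H) α) :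
    ∃ f, IsExtremalWeight H α f := by
  obtain ⟨g, hg, hMg⟩ := exists_pos_eigenvector (graphJoin_connected G H hH) α
  have := (graphJoin_connected G H hH).nonempty
  have hdiff : ∀ H' : SimpleGraph W,
      g ⬝ᵥ (generalMatrix (graphJoin G H') α).mulVec g -
        g ⬝ᵥ (generalMatrix (graphJoin G H) α).mulVec g =
      (g ∘ Sum.inr) ⬝ᵥ (generalMatrix H' α).mulVec (g ∘ Sum.inr) -
        (g ∘ Sum.inr) ⬝ᵥ (generalMatrix H α).mulVec (g ∘ Sum.inr) := by
    intro H'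
    simp only [dotProduct, Fintype.sum_sum_type, generalMatrix_graphJoin_mulVec_inl,
      generalMatrix_graphJoin_mulVec_inr, mul_add, Finset.sum_add_distrib, Function.comp_apply]
    ring
  have hsq : g ⬝ᵥ (generalMatrix (graphJoin G H) α).mulVec g =
      generalSpectralRadius (graphJoin G H) α * (g ⬝ᵥ g) := by
    rw [hMg, dotProduct_smul, smul_eq_mul]
  have hgg : 0 < g ⬝ᵥ g :=
    Finset.sum_pos (fun x _ => mul_pos (hg x) (hg x)) Finset.univ_nonempty
  refine ⟨g ∘ Sum.inr, fun w => hg _, fun H' hH' hd => ?_, fun H' hH' hd heq => ?_⟩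
  · have h1 := dotProduct_generalMatrix_le (graphJoin G H') α g
    have h2 := mul_le_mul_of_nonneg_right (hmax H' hH' hd) hgg.le
    linarith [hdiff H']
  · have h2 := mul_le_mul_of_nonneg_right (hmax H' hH' hd) hgg.le
    have h3 := hdiff H'
    have h4 := dotProduct_generalMatrix_le (graphJoin G H') α g
    -- A tie makes `g` attain the Rayleigh bound of `G ∨ H'` too, and the two radii coincide;
    -- comparing rows on `W` cancels all but `H'` and `H`.
    have h5 := generalMatrix_mulVec_eq_of_dotProduct_eq (graphJoin G H') α g (by linarith)
    have h6 : generalSpectralRadius (graphJoin G H') α =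
        generalSpectralRadius (graphJoin G H) α := by
      refine mul_right_cancel₀ hgg.ne' ?_
      linarith
    funext w
    have h7 := congrFun (h5.trans ((congrArg (· • g) h6).trans hMg.symm)) (Sum.inr w)
    rw [generalMatrix_graphJoin_mulVec_inr, generalMatrix_graphJoin_mulVec_inr] at h7
    linarith

end Join

/-! ### Invariance under isomorphism. -/

section Transport

variable {V W : Type*} {G : SimpleGraph V} {H : SimpleGraph W}

theorem SimpleGraph.Connected.dist_iso (hG : G.Connected) (e : G ≃g H) (u v : V) :
    H.dist (e u) (e v) = G.dist u v := by
  refine le_antisymm ?_ ?_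
  · obtain ⟨w, hw⟩ := hG.exists_walk_length_eq_dist u v
    rw [← hw, ← SimpleGraph.Walk.length_map e.toHom w]
    exact SimpleGraph.dist_le _
  · obtain ⟨w, hw⟩ := (e.connected_iff.1 hG).exists_walk_length_eq_dist (e u) (e v)
    have h := SimpleGraph.dist_le (w.map e.symm.toHom)
    rw [SimpleGraph.Walk.length_map, hw] at h
    have h1 : e.symm.toHom (e u) = u := e.symm_apply_apply u
    have h2 : e.symm.toHom (e v) = v := e.symm_apply_apply v
    rwa [h1, h2] at h

variable [Fintype V] [Fintype W]

theorem IsCCyclic.of_iso {c : ℕ} (hG : IsCCyclic G c) (e : G ≃g H) : IsCCyclic H c := by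
  refine ⟨e.connected_iff.1 hG.1, ?_⟩
  rw [← Fintype.card_congr e.toEquiv, ← hG.2, ← Nat.card_coe_set_eq, ← Nat.card_coe_set_eq,
    Nat.card_congr e.mapEdgeSet]

theorem HasDegreeSequence.of_iso {n : ℕ} {π : Fin n → ℕ} (hG : HasDegreeSequence G π)
    (e : G ≃g H) : HasDegreeSequence H π := by
  classical
  obtain ⟨v, hv⟩ := hG
  refine ⟨v.trans e.toEquiv, fun i => ?_⟩
  rw [← hv i]
  exact e.degree_eq (v i)

theorem IsBFSGraph.of_iso (hG : IsBFSGraph G) (e : G ≃g H) : IsBFSGraph H := by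
  classical
  obtain ⟨hc, m, v, hv⟩ := hG
  have hdeg : ∀ x, H.degree (e x) = G.degree x := fun x => e.degree_eq x
  refine ⟨e.connected_iff.1 hc, m, v.trans e.toEquiv, ?_, ?_, ?_⟩
  · intro i j hij
    have h := hv.degree_antitone i j hij
    rw [← hdeg, ← hdeg] at h
    exact h
  · intro i j hij
    have h := hv.dist_monotone i j hij
    rw [← hc.dist_iso e, ← hc.dist_iso e] at h
    exact h
  · intro u x w y hw hy h1 h2 h3 hlt
    obtain ⟨u, rfl⟩ := e.surjective u
    obtain ⟨x, rfl⟩ := e.surjective x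
    obtain ⟨w, rfl⟩ := e.surjective w
    obtain ⟨y, rfl⟩ := e.surjective y
    have h0 : (v.trans e.toEquiv) 0 = e (v 0) := rfl
    have hs : ∀ z, (v.trans e.toEquiv).symm (e z) = v.symm z := fun z =>
      congrArg v.symm (e.toEquiv.symm_apply_apply z)
    rw [h0, hc.dist_iso e, hc.dist_iso e] at h1 h2 h3
    rw [hs, hs] at hlt ⊢
    simp only [Set.mem_sdiff, SimpleGraph.mem_neighborSet, e.map_adj_iff] at hw hy
    exact hv.next_layer u x w y hw hy h1 h2 h3 hlt

theorem isTree_iff_isCCyclic : G.IsTree ↔ IsCCyclic G 0 := by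
  rw [SimpleGraph.isTree_iff_connected_and_card, IsCCyclic, add_zero, Nat.card_coe_set_eq,
    Nat.card_eq_fintype_card]

-- The handshake formula fixes the number of edges, so connected competitors with permuted degrees
-- are again trees when `H` is.
open scoped Classical in
theorem IsCCyclic.of_connected_of_degree {G H : SimpleGraph V} {c : ℕ} (hH : IsCCyclic H c)
    (hG : G.Connected) (hd : ∃ σ : Equiv.Perm V, ∀ x, G.degree x = H.degree (σ x)) :
    IsCCyclic G c := by
  obtain ⟨σ, hσ⟩ := hd
  have h1 := G.sum_degrees_eq_twice_card_edges
  have h2 := H.sum_degrees_eq_twice_card_edges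
  rw [Finset.sum_congr rfl fun x _ => hσ x, Equiv.sum_comp σ (fun x => H.degree x)] at h1
  refine ⟨hG, ?_⟩
  rw [← hH.2, Set.ncard_eq_toFinset_card', Set.ncard_eq_toFinset_card']
  have h3 : G.edgeFinset.card = H.edgeFinset.card := by omega
  exact congrArg (· + 1) h3

end Transport

/-! ### Degree sequences of cones. -/

section Cone

variable {n t : ℕ} {π : Fin n → ℕ}

/-- The vertices of a cone, listed with the `t` vertices of the complete graph first. -/
def coneEquiv (ht : t ≤ n) {W : Type*} (e : Fin (n - t) ≃ W) : Fin t ⊕ W ≃ Fin n :=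
  ((Equiv.sumCongr (Equiv.refl _) e.symm).trans finSumFinEquiv).trans (finCongr (by omega))

theorem coneEquiv_inl (ht : t ≤ n) {W : Type*} (e : Fin (n - t) ≃ W) (i : Fin t) :
    (coneEquiv ht e (Sum.inl i) : ℕ) = i := by
  simp [coneEquiv]

theorem coneEquiv_inr (ht : t ≤ n) {W : Type*} (e : Fin (n - t) ≃ W) (j : Fin (n - t)) :
    (coneEquiv ht e (Sum.inr (e j)) : ℕ) = t + j := by
  simp [coneEquiv]

open scoped Classical in
theorem coneDegree_inl (ht : t ≤ n) (H : SimpleGraph (Fin (n - t))) (i : Fin t) :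
    (graphJoin (⊤ : SimpleGraph (Fin t)) H).degree (Sum.inl i) = n - 1 := by
  have := i.isLt
  have h : ∀ inst : Fintype ((⊤ : SimpleGraph (Fin t)).neighborSet i),
      @SimpleGraph.degree _ ⊤ i inst = t - 1 := by
    intro inst
    have h := SimpleGraph.complete_graph_degree i
    rw [Fintype.card_fin] at h
    rw [← h]
    convert rfl
  rw [graphJoin_degree_inl, Fintype.card_fin, h]
  omega

open scoped Classical in
/-- The degree sequence of a cone, in non-increasing order. -/
theorem degree_cone_symm (ht : t ≤ n) (hmono : Antitone π) {H : SimpleGraph (Fin (n - t))}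
    (hH : HasDegreeSequence (graphJoin (⊤ : SimpleGraph (Fin t)) H) π) :
    ∃ e : Fin (n - t) ≃ Fin (n - t), Antitone (fun j => H.degree (e j)) ∧
      ∀ x, (graphJoin (⊤ : SimpleGraph (Fin t)) H).degree x = π (coneEquiv ht e x) := by
  obtain ⟨v, hv⟩ := hH
  obtain ⟨e, he⟩ := exists_equiv_monotone_comp (Fintype.card_fin (n - t))
    (fun x => OrderDual.toDual (H.degree x))
  have he' : Antitone (fun j => H.degree (e j)) := fun i j hij => he hij
  have h := antitone_comp_equiv_unique
    (fun x => (graphJoin (⊤ : SimpleGraph (Fin t)) H).degree x) (coneEquiv ht e).symm v ?_ ?_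
  · refine ⟨e, he', fun x => ?_⟩
    have h1 := congrFun h (coneEquiv ht e x)
    rw [Function.comp_apply, Function.comp_apply, hv] at h1
    rw [← h1, (coneEquiv ht e).symm_apply_apply]
  · intro a b hab
    obtain ⟨x, rfl⟩ := (coneEquiv ht e).surjective a
    obtain ⟨y, rfl⟩ := (coneEquiv ht e).surjective b
    rw [Function.comp_apply, Function.comp_apply, (coneEquiv ht e).symm_apply_apply,
      (coneEquiv ht e).symm_apply_apply]
    rw [Fin.le_def] at hab
    rcases x with i | x
    -- Vertices of the complete part have the largest possible degree `n - 1`, so listing them first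
    -- is compatible with sorting.
    · rw [coneDegree_inl ht]
      have := (graphJoin (⊤ : SimpleGraph (Fin t)) H).degree_lt_card_verts y
      rw [Fintype.card_sum, Fintype.card_fin, Fintype.card_fin] at this
      omega
    · obtain ⟨k, rfl⟩ := e.surjective x
      rcases y with j | y
      · rw [coneEquiv_inl, coneEquiv_inr] at hab
        omega
      · obtain ⟨l, rfl⟩ := e.surjective y
        rw [coneEquiv_inr, coneEquiv_inr] at hab
        rw [graphJoin_degree_inr, graphJoin_degree_inr]
        exact Nat.add_le_add_left (he' (by rw [Fin.le_def]; omega)) _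
  · intro a b hab
    have := hmono hab
    rw [← hv, ← hv] at this
    exact this

theorem antitone_reducedSequence (hmono : Antitone π) : Antitone (reducedSequence π t) :=
  fun i j hij => Nat.sub_le_sub_right (hmono (by
    rw [Fin.le_def]
    exact Nat.add_le_add_left hij t)) t

theorem hasDegreeSequence_reducedSequence (ht : t ≤ n) (hmono : Antitone π)
    {H : SimpleGraph (Fin (n - t))}
    (hH : HasDegreeSequence (graphJoin (⊤ : SimpleGraph (Fin t)) H) π) :
    HasDegreeSequence H (reducedSequence π t) := by
  classical
  obtain ⟨e, -, he⟩ := degree_cone_symm ht hmono hH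
  refine ⟨e, fun j => ?_⟩
  have h := he (Sum.inr (e j))
  rw [graphJoin_degree_inr, Fintype.card_fin] at h
  have h1 : coneEquiv ht e (Sum.inr (e j)) = ⟨t + j, by have := j.isLt; omega⟩ :=
    Fin.ext (coneEquiv_inr ht e j)
  rw [h1] at h
  rw [reducedSequence, ← h]
  omega

/-- The given cone over `H` shows that the first `t` entries of `π` are `n - 1` and that the later
ones are at least `t`; the reduced sequence then recovers `π`. -/
theorem hasDegreeSequence_graphJoin (ht : t ≤ n) (hmono : Antitone π)
    {H H' : SimpleGraph (Fin (n - t))}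
    (hH : HasDegreeSequence (graphJoin (⊤ : SimpleGraph (Fin t)) H) π)
    (hH' : HasDegreeSequence H' (reducedSequence π t)) :
    HasDegreeSequence (graphJoin (⊤ : SimpleGraph (Fin t)) H') π := by
  classical
  obtain ⟨e, -, he⟩ := degree_cone_symm ht hmono hH
  obtain ⟨e', he'⟩ := hH'
  refine ⟨(coneEquiv ht e').symm, fun a => ?_⟩
  obtain ⟨x, rfl⟩ := (coneEquiv ht e').surjective a
  rw [Equiv.symm_apply_apply]
  rcases x with i | x
  · have h := he (Sum.inl i)
    rw [coneDegree_inl ht] at h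
    rw [coneDegree_inl ht, h]
    exact congrArg π (Fin.ext ((coneEquiv_inl ht e i).trans (coneEquiv_inl ht e' i).symm))
  · obtain ⟨j, rfl⟩ := e'.surjective x
    have h := he (Sum.inr (e j))
    have h1 : coneEquiv ht e (Sum.inr (e j)) = coneEquiv ht e' (Sum.inr (e' j)) :=
      Fin.ext (by rw [coneEquiv_inr, coneEquiv_inr])
    have h2 : coneEquiv ht e' (Sum.inr (e' j)) = ⟨t + j, by have := j.isLt; omega⟩ :=
      Fin.ext (coneEquiv_inr ht e' j)
    have h3 := he' j
    rw [reducedSequence, ← h2] at h3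
    rw [graphJoin_degree_inr, Fintype.card_fin, h1] at h
    rw [graphJoin_degree_inr, Fintype.card_fin]
    omega

/-- A maximal graph of the class is the cone over the BFS-tree. -/
theorem IsThetaMaximal.exists_isBFSGraph (ht : t + 2 ≤ n) (hmono : Antitone π) {α : ℝ}
    (hα : 0 ≤ α) {G : SimpleGraph (Fin n)} (hG : IsThetaMaximal α (coneClass π t 0) G) :
    ∃ H : SimpleGraph (Fin (n - t)), IsCCyclic H 0 ∧ HasDegreeSequence H (reducedSequence π t) ∧
      IsBFSGraph H ∧ Nonempty (G ≃g graphJoin (⊤ : SimpleGraph (Fin t)) H) := by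
  classical
  obtain ⟨⟨hGπ, H, hH, ⟨φ⟩⟩, hmax⟩ := hG
  have hJ := hGπ.of_iso φ
  have hHδ := hasDegreeSequence_reducedSequence (by omega) hmono hJ
  obtain ⟨f, hf⟩ := exists_isExtremalWeight (⊤ : SimpleGraph (Fin t)) H α hH.1 (by
    rintro H' hH' ⟨σ, hσ⟩
    have hδ' : HasDegreeSequence H' (reducedSequence π t) := by
      obtain ⟨v, hv⟩ := hHδ
      exact ⟨v.trans σ.symm, fun i => by
        rw [← hv i, hσ, Equiv.trans_apply, σ.apply_symm_apply]⟩
    let ψ := SimpleGraph.Iso.map φ.toEquiv.symm (graphJoin (⊤ : SimpleGraph (Fin t)) H')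
    have h := hmax _ ⟨(hasDegreeSequence_graphJoin (by omega) hmono hJ hδ').of_iso ψ, H',
      hH.of_connected_of_degree hH' ⟨σ, hσ⟩, ⟨ψ.symm⟩⟩
    rwa [← generalSpectralRadius_congr ψ, generalSpectralRadius_congr φ] at h)
  exact ⟨H, hH, hHδ, ⟨hH.1, hf.exists_isBFSOrdering hα hH⟩, ⟨φ⟩⟩

end Cone

/-! ### The main theorem. -/

theorem theorem4p2 (n t : ℕ) (ht : t + 2 ≤ n) (π : Fin n → ℕ) (hmono : Antitone π)
    (hne : (coneClass π t 0).Nonempty) (α : ℝ) (hα : 0 ≤ α) :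
    ((bfsTree (reducedSequence π t)).IsTree ∧
      HasDegreeSequence (bfsTree (reducedSequence π t)) (reducedSequence π t) ∧
      IsBFSGraph (bfsTree (reducedSequence π t)) ∧
      ∀ T : SimpleGraph (Fin (n - t)), T.IsTree → HasDegreeSequence T (reducedSequence π t) →
        IsBFSGraph T → Nonempty (T ≃g bfsTree (reducedSequence π t))) ∧
    ∀ G : SimpleGraph (Fin n), IsThetaMaximal α (coneClass π t 0) G ↔
      Nonempty (G ≃g graphJoin (⊤ : SimpleGraph (Fin t)) (bfsTree (reducedSequence π t))) := by
  have hδ := antitone_reducedSequence (t := t) hmono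
  have hiso : ∀ G : SimpleGraph (Fin n), IsThetaMaximal α (coneClass π t 0) G →
      Nonempty (G ≃g graphJoin (⊤ : SimpleGraph (Fin t)) (bfsTree (reducedSequence π t))) := by
    intro G hG
    obtain ⟨H, hH, hHδ, hbfs, ⟨φ⟩⟩ := hG.exists_isBFSGraph ht hmono hα
    obtain ⟨ψ⟩ := nonempty_iso_bfsTree hH hbfs.2 hδ hHδ
    exact ⟨φ.trans (graphJoinCongrRight _ ψ)⟩
  obtain ⟨G₀, hG₀, hmax⟩ := (Set.toFinite (coneClass π t 0)).exists_maximalFor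
    (fun G => generalSpectralRadius G α) _ hne
  have hG₀' : IsThetaMaximal α (coneClass π t 0) G₀ := ⟨hG₀, fun G' hG' => by
    by_contra! hlt
    exact absurd (hmax hG' hlt.le) (not_le.2 hlt)⟩
  obtain ⟨H, hH, hHδ, hbfs, ⟨φ⟩⟩ := hG₀'.exists_isBFSGraph ht hmono hα
  obtain ⟨ψ⟩ := nonempty_iso_bfsTree hH hbfs.2 hδ hHδ
  -- The properties of `bfsTree` are inherited from the tree `H` of one maximal graph. For the
  -- converse, any graph isomorphic to the cone is isomorphic to that maximal graph.
  refine ⟨⟨isTree_iff_isCCyclic.2 (hH.of_iso ψ), hHδ.of_iso ψ, hbfs.of_iso ψ,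
    fun T hT hTδ hTbfs => nonempty_iso_bfsTree (isTree_iff_isCCyclic.1 hT) hTbfs.2 hδ hTδ⟩,
    fun G => ⟨hiso G, ?_⟩⟩
  rintro ⟨χ⟩
  let ω := (φ.trans (graphJoinCongrRight _ ψ)).trans χ.symm
  refine ⟨⟨hG₀.1.of_iso ω, _, hH.of_iso ψ, ⟨χ⟩⟩, fun G' hG' => ?_⟩
  rw [← generalSpectralRadius_congr ω]
  exact hG₀'.2 G' hG'
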